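/- Let $\Sigma$ be a finite signature all of whose symbols have arity at most $2$, and let $V$ be a finite set of variables. A DTA $A=\langle Q,\Sigma,\delta\rangle$ is a (not necessarily complete) deterministic bottom-up tree automaton with finite state set $Q$ and without accepting states; $\mathcal L(A,q)$ is the set of ground terms that $A$ evaluates to $q$. $A$ is a $1$-or-$n$ DTA if for every $q\in Q$ either $|\mathcal L(A,q)|=1$ or $|\mathcal L(A,q)|\ge n$. A restricted regular constraint is a tuple $R=\langle A,V,C,W,h\rangle$ with $A$ a DTA, $C:V\to Q$, $W\subseteq V$ and $h\in\mathbb N$. A solution of $R$ is a map $\varphi:V\to T_\Sigma$ with $\varphi(x)\in\mathcal L(A,C(x))$ for all $x\in V$ and $\mathrm{height}(\varphi(x))\le h$ for all $x\in W$. For a finite set $S$ of terms over $\Sigma$ and $V$, $\mathcal L(\langle S,R\rangle)$ is the set of all $\varphi(t)$ with $t\in S$ and $\varphi$ a solution of $R$; its elements are the instances of $\langle S,R\rangle$. $|S|$ is the cardinality of $S$ and $|s|$ the number of nodes of the term $s$; constants and variables have height $0$. A term $s$ is determined at a position $p$ if $p$ is a non-variable position of $s$ or some prefix of $p$ is labeled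 by a constant in $s$. Let $R=\langle A,V,C,W,h\rangle$ be a restricted regular constraint, $S$ a finite set of terms over $\Sigma$ and $V$, and $s$ a term over $\Sigma$ and $V\setminus W$. Assume that $s$ is determined at every non-variable position of every term of $S$, that $A$ is a $1$-or-$(|S|+1)$ DTA, and that $h\ge |Q|+\mathrm{height}(s)$. 1. It is decidable in time $O\bigl(1+2^{|S|}\,|s|^{2|S|+1}\,|S|\bigr)$ whether $\langle\{s\},R\rangle$ has an instance that is not in $\mathcal L(\langle S,R\rangle)$. Precisely: there is one program of a unit-cost random access machine (with addition, truncated subtraction and indirect addressing) and one constant, both independent of $\Sigma,A,V,C,W,h,S,s$, such that the program decides this within the constant times $1+2^{|S|}|s|^{2|S|+1}|S|$ steps. The input is given in random access memory: $s$ and the terms of $S$ as linked trees, $\delta$, $C$, $W$ as tables, the numbers $|S|$, $h$, $|Q|$, and, for every state $q$, the two bits telling whether $|\mathcal L(A,q)|=1$ and whether $|\mathcal L(A,q)|=\infty$. 2. If $\langle\{s\},R\rangle$ has an instance not in $\mathcal L(\langle S,R\rangle)$, then for every variable $x$ that occurs at least twice in $s$ and satisfies $|\mathcal L(A,C(x))|=\infty$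 there are solutions $\varphi_0,\varphi_1,\varphi_2,\dots$ of $R$ such that $\varphi_i(s)\notin\mathcal L(\langle S,R\rangle)$ for all $i$ and the terms $\varphi_i(x)$ are pairwise different. -/

import Mathlib

universe u v w

/-! ### Terms

Symbols are the elements of `F`, with arities `ar : F → ℕ`. `Term ar V` is `T_Σ(V)`;
ground terms, i.e. the elements of `T_Σ`, are `Term ar Empty`. -/

inductive Term {F : Type*} (ar : F → ℕ) (V : Type*) where
  | var (x : V) : Term ar V
  | app (f : F) (args : Fin (ar f) → Term ar V) : Term ar V

namespace Term

variable {F V V' : Type*} {ar : F → ℕ}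

/-- `|t|`, the number of nodes. -/
def size : Term ar V → ℕ
  | var _ => 1
  | app _ args => 1 + ∑ i, (args i).size

/-- The height; constants and variables have height `0`. -/
def height : Term ar V → ℕ
  | var _ => 0
  | app _ args => Finset.univ.sup fun i => 1 + (args i).height

/-- Simultaneous substitution of terms for variables. -/
def subst (φ : V → Term ar V') : Term ar V → Term ar V'
  | var x => φ x
  | app f args => app f fun i => (args i).subst φ

/-- The subterm `t/p`; it is `none` if `p` is not a position of `t`. Positions are lists of child
indices, read from the root, the children of a node being numbered from `0`. -/
def subtermAt : Term ar V → List ℕ → Option (Term ar V)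
  | t, [] => some t
  | var _, _ :: _ => none
  | app f args, i :: p => if h : i < ar f then (args ⟨i, h⟩).subtermAt p else none

/-- The set of non-variable positions. -/
def nonvarPos (t : Term ar V) : Set (List ℕ) :=
  {p | ∃ f args, t.subtermAt p = some (app f args)}

/-- The set of positions labeled by the variable `x`. -/
def varPos (t : Term ar V) (x : V) : Set (List ℕ) :=
  {p | t.subtermAt p = some (var x)}

/-- The set of variables occurring in `t`. -/
def vars (t : Term ar V) : Set V := {x | (t.varPos x).Nonempty}

/-- `t` is determined at `p`: either `p` is a non-variable position of `t`, or some prefix of `p`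
is labeled by a constant in `t`. -/
def DeterminedAt (t : Term ar V) (p : List ℕ) : Prop :=
  p ∈ t.nonvarPos ∨
    ∃ p', p' <+: p ∧ ∃ f args, t.subtermAt p' = some (app f args) ∧ ar f = 0

end Term

/-! ### Deterministic tree automata without accepting states -/

/-- A deterministic bottom-up tree automaton, not necessarily complete: `δ f qs = some q` means
that `f(qs) → q` is a transition. -/
structure DTA {F : Type*} (ar : F → ℕ) (Q : Type*) where
  δ : (f : F) → (Fin (ar f) → Q) → Option Q

namespace DTA

variable {F Q : Type*} {ar : F → ℕ}

/-- The state `A(t)`, which is undefined if a transition is missing. -/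
def run (A : DTA ar Q) : Term ar Empty → Option Q
  | .var x => x.elim
  | .app f args =>
      if h : ∀ i, (A.run (args i)).isSome then A.δ f fun i => (A.run (args i)).get (h i) else none

/-- `L(A, q)`. -/
def lang (A : DTA ar Q) (q : Q) : Set (Term ar Empty) := {t | A.run t = some q}

/-- `A` is a `1`-or-`n` DTA. -/
def IsOneOr (A : DTA ar Q) (n : ℕ) : Prop :=
  ∀ q, (A.lang q).encard = 1 ∨ (n : ℕ∞) ≤ (A.lang q).encard

end DTA

/-! ### Restricted regular constraints -/

/-- A restricted regular constraint `⟨A, V, C, W, h⟩`. -/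
structure RestrictedConstraint {F : Type*} (ar : F → ℕ) (Q V : Type*) where
  A : DTA ar Q
  C : V → Q
  W : Set V
  h : ℕ

namespace RestrictedConstraint

variable {F Q V : Type*} {ar : F → ℕ}

def IsSolution (R : RestrictedConstraint ar Q V) (φ : V → Term ar Empty) : Prop :=
  ∀ x, φ x ∈ R.A.lang (R.C x) ∧ (x ∈ R.W → (φ x).height ≤ R.h)

/-- `L(⟨S, R⟩)`, the set of instances of `⟨S, R⟩`. -/
def lang (R : RestrictedConstraint ar Q V) (S : Set (Term ar V)) : Set (Term ar Empty) :=
  {t | ∃ φ, R.IsSolution φ ∧ ∃ s ∈ S, t = s.subst φ}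

end RestrictedConstraint

/-! ### Machine model

A unit-cost random access machine over the natural numbers, with a read-only random access input
`I : ℕ → ℕ` and a work memory `M : ℕ → ℕ`, both with indirect addressing; the arithmetic operations
are addition and truncated subtraction. Programs are structured. Every literal, memory access,
arithmetic operation, test and store costs one step. -/

namespace RAM

inductive Expr where
  | lit (n : ℕ) : Expr
  | input (a : Expr) : Expr
  | work (a : Expr) : Expr
  | add (a b : Expr) : Expr
  | sub (a b : Expr) : Expr

def Expr.eval (I M : ℕ → ℕ) : Expr → ℕ
  | lit n => n
  | input a => I (a.eval I M)
  | work a => M (a.eval I M)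
  | add a b => a.eval I M + b.eval I M
  | sub a b => a.eval I M - b.eval I M

def Expr.cost : Expr → ℕ
  | lit _ => 1
  | input a => a.cost + 1
  | work a => a.cost + 1
  | add a b => a.cost + b.cost + 1
  | sub a b => a.cost + b.cost + 1

inductive Prog where
  /-- store the value of `e` in the work cell whose address is the value of `a` -/
  | store (a e : Expr) : Prog
  | seq (p q : Prog) : Prog
  /-- run `p` if the value of `e` is nonzero, and `q` otherwise -/
  | cond (e : Expr) (p q : Prog) : Prog
  /-- run `p` as long as the value of `e` is nonzero -/
  | loop (e : Expr) (p : Prog) : Prog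

/-- `Exec I p M M' n`: on input `I`, the program `p` started with work memory `M` halts after
exactly `n` steps with work memory `M'`. At most one rule applies to any `I`, `p`, `M`. -/
inductive Exec (I : ℕ → ℕ) : Prog → (ℕ → ℕ) → (ℕ → ℕ) → ℕ → Prop
  | store (a e : Expr) (M : ℕ → ℕ) :
      Exec I (.store a e) M (Function.update M (a.eval I M) (e.eval I M)) (a.cost + e.cost + 1)
  | seq {p q : Prog} {M M' M'' : ℕ → ℕ} {m n : ℕ} :
      Exec I p M M' m → Exec I q M' M'' n → Exec I (.seq p q) M M'' (m + n)
  | condTrue {e : Expr} {p q : Prog} {M M' : ℕ → ℕ} {n : ℕ} :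
      e.eval I M ≠ 0 → Exec I p M M' n → Exec I (.cond e p q) M M' (e.cost + 1 + n)
  | condFalse {e : Expr} {p q : Prog} {M M' : ℕ → ℕ} {n : ℕ} :
      e.eval I M = 0 → Exec I q M M' n → Exec I (.cond e p q) M M' (e.cost + 1 + n)
  | loopTrue {e : Expr} {p : Prog} {M M' M'' : ℕ → ℕ} {m n : ℕ} :
      e.eval I M ≠ 0 → Exec I p M M' m → Exec I (.loop e p) M' M'' n →
        Exec I (.loop e p) M M'' (e.cost + 1 + m + n)
  | loopFalse {e : Expr} {p : Prog} {M : ℕ → ℕ} :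
      e.eval I M = 0 → Exec I (.loop e p) M M (e.cost + 1)

/-- On input `I`, started with an all-zero work memory, `p` halts within `T` steps, with `1` in work
cell `0` if `P` holds and with `0` there if `P` fails. -/
def DecidesWithin (p : Prog) (I : ℕ → ℕ) (P : Prop) (T : ℕ) : Prop :=
  ∃ (M : ℕ → ℕ) (n : ℕ), Exec I p (fun _ => 0) M n ∧ n ≤ T ∧ (P → M 0 = 1) ∧ (¬ P → M 0 = 0)

end RAM

/-! ### Input format

Terms are given as linked trees, and functions on states, variables and symbols as arrays. -/

/-- Names, as natural numbers, for the symbols, states and variables. -/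
structure Naming (F Q V : Type*) where
  symb : F ↪ ℕ
  state : Q ↪ ℕ
  var : V ↪ ℕ

namespace Naming

variable {F Q V : Type*} {ar : F → ℕ}

/-- The term `t` is stored at address `a` of `I`. A variable node is `0`, name of the variable; a
node with a `k`-ary symbol is `k + 1`, name of the symbol, addresses of the `k` children. -/
def TermAt (ν : Naming F Q V) (I : ℕ → ℕ) : ℕ → Term ar V → Prop
  | a, .var x => I a = 0 ∧ I (a + 1) = ν.var x
  | a, .app f args =>
      I a = ar f + 1 ∧ I (a + 1) = ν.symb f ∧ ∀ i : Fin (ar f), ν.TermAt I (I (a + 2 + i)) (args i)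

open Classical in
/-- The input memory `I` represents the instance consisting of `R`, `S` and `s`. Cells `0` to `9`
hold the address of `s`, the cardinality of `S`, the base address of an array with the addresses of
the terms of `S`, the base addresses of the arrays for `δ`, `C`, `W`, for the states with a
one-element language and for the states with an infinite language, the number `h`, and `|Q|`.
The array for `δ` is an array of arrays, of depth `k` below a `k`-ary symbol; its entries are
`0` for an undefined transition and `1 +` the name of the state for a defined one. -/
structure Represents (ν : Naming F Q V) (I : ℕ → ℕ) (R : RestrictedConstraint ar Q V)
    (S : Finset (Term ar V)) (s : Term ar V) : Prop where
  term : ν.TermAt I (I 0) s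
  card : I 1 = S.card
  terms : ∃ e : Fin S.card ≃ S, ∀ i : Fin S.card, ν.TermAt I (I (I 2 + i)) (e i : Term ar V)
  trans : ∀ f (qs : Fin (ar f) → Q),
    (List.ofFn qs).foldl (fun b q => I (b + ν.state q)) (I (I 3 + ν.symb f)) =
      ((R.A.δ f qs).map fun q => ν.state q + 1).getD 0
  varState : ∀ x, I (I 4 + ν.var x) = ν.state (R.C x)
  varRestricted : ∀ x, I (I 5 + ν.var x) = if x ∈ R.W then 1 else 0
  singleton : ∀ q, I (I 6 + ν.state q) = if (R.A.lang q).encard = 1 then 1 else 0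
  infinite : ∀ q, I (I 7 + ν.state q) = if (R.A.lang q).Infinite then 1 else 0
  bound : I 8 = R.h
  numStates : I 9 = Nat.card Q

end Naming

/-! Fix `t ∈ S` and match it against `s`. Since `s` is determined at all non-variable positions of
`t`, a variable of `s` never stands opposite a function symbol of `t`. Matching therefore only binds
variables of `t` to subterms of `s` and, at repeated variables, asks for equations between subterms
of `s`. This yields a dichotomy (`refutable_or_forall_solves`): either every instance of `s` is an
instance of `t`, or there is an obstruction of one of three kinds (`Refutable`). No solution makes
the match succeed, or success bounds the height of a variable outside `W` with infinite language, or
success forces an equation over `V \ W` that some solution violates. The hypothesis `h ≥ |Q| +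
height(s)` enters when no obstruction is found: a variable of `W` is then bound to a subterm of `s`
whose variables have finite languages, hence values of height below `|Q|`
(`DTA.height_lt_of_mem_lang`), so the height bound `h` is respected.

Obstructions for different `t` can be exploited simultaneously (`exists_isSolution_forall_not`). An
equation that holds for two values of a variable, the others being fixed, holds for all its values
(`subst_update_eq_subst_update`). So each disequation excludes at most one value of each variable,
and `|S| + 1` available values always leave one; the variables are fixed one at a time
(`exists_isSolution_forall_ne`). Hence `s` has an instance outside the language of `S` iff each
single `t` has an obstruction. Infinite languages even allow any finite set of values to be avoided,
so the values of `x` in the second claim cannot form a finite set.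

Looking for an obstruction takes at most `2|s|` worklist steps per `t`, once the states of the
subterms of `s` have been tabulated in one traversal. The machine thus needs `O(1 + |s| |S|)` steps,
which is below the required bound. -/

/-! ### Terms: heights, and equations as functions of one variable -/

namespace Term

variable {F V V' : Type*} {ar : F → ℕ}

/-- Every variable occurring in the term satisfies `P`. -/
def AllVars (P : V → Prop) : Term ar V → Prop
  | var x => P x
  | app _ args => ∀ i, (args i).AllVars P

theorem allVars_of_forall_mem_vars {P : V → Prop} {t : Term ar V} (h : ∀ x ∈ t.vars, P x) :
    t.AllVars P := by
  induction t with
  | var x => exact h x ⟨[], rfl⟩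
  | app f args ih =>
    intro i
    refine ih i fun x hx => h x ?_
    obtain ⟨p, hp⟩ := hx
    refine ⟨i :: p, ?_⟩
    simpa [varPos, subtermAt] using hp

theorem subst_congr {P : V → Prop} {t : Term ar V} (ht : t.AllVars P) {φ ψ : V → Term ar V'}
    (h : ∀ x, P x → φ x = ψ x) : t.subst φ = t.subst ψ := by
  induction t with
  | var x => exact h x ht
  | app f args ih =>
    simp only [subst]
    congr 1
    funext i
    exact ih i (ht i)

/-- The value of an occurring variable is a subterm of the result. Applied with `P` saying that the
language is finite, this turns a height bound on the whole instance into one on a variable with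
infinite language. -/
theorem exists_height_le_of_not_allVars {P R : V → Prop} {t : Term ar V} (hR : t.AllVars R)
    (hP : ¬ t.AllVars P) :
    ∃ y, ¬ P y ∧ R y ∧ ∀ φ : V → Term ar V', (φ y).height ≤ (t.subst φ).height := by
  induction t with
  | var x => exact ⟨x, hP, hR, fun φ => le_rfl⟩
  | app f args ih =>
    simp only [AllVars, not_forall] at hP
    obtain ⟨i, hi⟩ := hP
    obtain ⟨y, h1, h2, h3⟩ := ih i (hR i) hi
    refine ⟨y, h1, h2, fun φ => (h3 φ).trans ?_⟩
    simp only [subst, height]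
    refine le_trans ?_ (Finset.le_sup (f := fun i => 1 + ((args i).subst φ).height)
      (Finset.mem_univ i))
    omega

theorem height_lt_height_app (f : F) (args : Fin (ar f) → Term ar V) (i : Fin (ar f)) :
    (args i).height < (app f args).height := by
  have := Finset.le_sup (f := fun i => 1 + (args i).height) (Finset.mem_univ i)
  simp only [height]
  omega

theorem height_app_le {f : F} {args : Fin (ar f) → Term ar V} {n : ℕ}
    (h : ∀ i, (args i).height < n) : (app f args).height ≤ n := by
  simp only [height]
  refine Finset.sup_le fun i _ => ?_
  have := h i
  omega

theorem exists_height_app_eq {f : F} {args : Fin (ar f) → Term ar V} {n : ℕ}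
    (h : (app f args).height = n + 1) : ∃ i, (args i).height = n := by
  by_contra! hne
  have h1 : ∀ i, (args i).height < n := fun i => by
    have h2 := height_lt_height_app f args i
    have := hne i
    omega
  have := height_app_le h1
  omega

theorem height_subst_le {P : V → Prop} {t : Term ar V} (ht : t.AllVars P) {φ : V → Term ar V'}
    {n : ℕ} (h : ∀ x, P x → (φ x).height ≤ n) : (t.subst φ).height ≤ t.height + n := by
  induction t with
  | var x => simpa [height, subst] using h x ht
  | app f args ih =>
    refine height_app_le fun i => ?_
    have h1 := ih i (ht i)
    have h2 := height_lt_height_app f args i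
    omega

theorem finite_setOf_height_lt [Finite F] (n : ℕ) : {t : Term ar Empty | t.height < n}.Finite := by
  induction n with
  | zero => simp
  | succ n ih =>
    refine (Set.finite_iUnion fun f : F =>
      (Set.Finite.pi fun _ : Fin (ar f) => ih).image (app f)).subset ?_
    intro t ht
    cases t with
    | var x => exact x.elim
    | app f args =>
      refine Set.mem_iUnion.2 ⟨f, args, fun i _ => ?_, rfl⟩
      have := height_lt_height_app f args i
      simp only [Set.mem_ofPred_eq] at ht ⊢
      omega

theorem size_pos (t : Term ar V) : 0 < t.size := by
  cases t <;> simp [size]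

theorem size_lt_size_app (f : F) (args : Fin (ar f) → Term ar V) (i : Fin (ar f)) :
    (args i).size < (app f args).size := by
  have := Finset.single_le_sum (f := fun i => (args i).size) (fun _ _ => Nat.zero_le _)
    (Finset.mem_univ i)
  simp only [size]
  omega

section Update

variable [DecidableEq V]

/-- Substituting for `y` two different terms gives equal results only if `y` does not matter. -/
theorem subst_update_eq_of_eq {t : Term ar V} {φ : V → Term ar V'} {y : V} {a b : Term ar V'}
    (hab : a ≠ b) (h : t.subst (Function.update φ y a) = t.subst (Function.update φ y b))
    (c : Term ar V') : t.subst (Function.update φ y c) = t.subst (Function.update φ y a) := by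
  induction t with
  | var x =>
    by_cases hx : x = y
    · subst hx; simp [subst] at h; exact (hab h).elim
    · simp [subst, hx]
  | app f args ih =>
    simp only [subst, app.injEq, heq_eq_eq, true_and] at h ⊢
    funext i
    exact ih i (congrFun h i)

/-- The two cases are that `y` does not occur and that its value is a subterm of the result; this is
the quantitative form of the occurs check. -/
theorem size_le_size_subst_update {t : Term ar V} {φ : V → Term ar V'} {y : V} :
    (∀ a b, t.subst (Function.update φ y a) = t.subst (Function.update φ y b)) ∨
      ∀ a, a.size ≤ (t.subst (Function.update φ y a)).size := by
  induction t with
  | var x =>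
    by_cases hx : x = y
    · subst hx; right; simp [subst]
    · left; simp [subst, hx]
  | app f args ih =>
    by_cases h : ∀ i, ∀ a b, (args i).subst (Function.update φ y a) =
        (args i).subst (Function.update φ y b)
    · left
      intro a b
      simp only [subst, app.injEq, heq_eq_eq, true_and]
      funext i
      exact h i a b
    · right
      rw [not_forall] at h
      obtain ⟨i, hi⟩ := h
      intro a
      exact ((ih i).resolve_left hi a).trans (size_lt_size_app f
        (fun i => (args i).subst (Function.update φ y a)) i).le

/-- A variable `y` is equal to a term other than `y` for at most one value of `y`. -/
theorem eq_of_eq_subst_update {t : Term ar V} {φ : V → Term ar V'} {y : V} {a b : Term ar V'}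
    (ht : t ≠ var y) (ha : a = t.subst (Function.update φ y a))
    (hb : b = t.subst (Function.update φ y b)) : a = b := by
  cases t with
  | var x =>
    have hx : x ≠ y := fun h => ht (by rw [h])
    simp only [subst, Function.update_of_ne hx] at ha hb
    rw [ha, hb]
  | app f args =>
    -- Occurs check: if some argument depended on `y`, then `a` would be smaller than itself.
    have key : ∀ i, ∀ a b, (args i).subst (Function.update φ y a) =
        (args i).subst (Function.update φ y b) := by
      intro i
      refine (size_le_size_subst_update (t := args i) (φ := φ) (y := y)).resolve_right
        fun h => ?_
      have h1 := h a
      have h2 := size_lt_size_app f (fun i => (args i).subst (Function.update φ y a)) i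
      have h3 := congrArg size ha
      simp only [subst] at h3
      omega
    rw [ha, hb]
    simp only [subst, app.injEq, heq_eq_eq, true_and]
    funext i
    exact key i a b

/-- An equation between terms that holds for two values of the variable `y` holds for all of
them, the other variables being kept fixed. -/
theorem subst_update_eq_subst_update {s t : Term ar V} {φ : V → Term ar V'} {y : V}
    {a b : Term ar V'} (hab : a ≠ b)
    (ha : s.subst (Function.update φ y a) = t.subst (Function.update φ y a))
    (hb : s.subst (Function.update φ y b) = t.subst (Function.update φ y b)) (c : Term ar V') :
    s.subst (Function.update φ y c) = t.subst (Function.update φ y c) := by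
  -- The case of a variable on one side, stated separately because either side can be the variable.
  -- For `x = y` the occurs check applies; for `x ≠ y` the term `t` has the same value at `a` and at
  -- `b`, hence ignores `y`.
  have aux : ∀ (x : V) (t : Term ar V),
      (var x).subst (Function.update φ y a) = t.subst (Function.update φ y a) →
      (var x).subst (Function.update φ y b) = t.subst (Function.update φ y b) →
      (var x).subst (Function.update φ y c) = t.subst (Function.update φ y c) := by
    intro x t ha hb
    by_cases hx : x = y
    · subst hx
      by_cases ht : t = var x
      · rw [ht]
      · simp only [subst, Function.update_self] at ha hb
        exact (hab (eq_of_eq_subst_update ht ha hb)).elim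
    · simp only [subst, Function.update_of_ne hx] at ha hb ⊢
      rw [ha]
      exact (subst_update_eq_of_eq hab (ha.symm.trans hb) c).symm
  induction s generalizing t with
  | var x => exact aux x t ha hb
  | app f args ih =>
    cases t with
    | var x => exact (aux x _ ha.symm hb.symm).symm
    | app g args' =>
      simp only [subst, app.injEq] at ha hb ⊢
      obtain ⟨rfl, ha⟩ := ha
      simp only [heq_eq_eq, true_and] at ha hb ⊢
      funext i
      exact ih i (congrFun ha i) (congrFun hb i)

end Update

/-- Determinedness passes to children: a witnessing constant prefix cannot be the root, since the
root symbol has the child `i`. -/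
theorem determinedAt_args {f : F} {args args' : Fin (ar f) → Term ar V}
    (h : ∀ r ∈ (app f args).nonvarPos, (app f args').DeterminedAt r) (i : Fin (ar f)) :
    ∀ r ∈ (args i).nonvarPos, (args' i).DeterminedAt r := by
  intro r hr
  rcases h (i :: r) (by simpa [nonvarPos, subtermAt] using hr) with h | ⟨p, hp, g, as, hg, h0⟩
  · left
    simpa [nonvarPos, subtermAt] using h
  · cases p with
    | nil =>
      simp only [subtermAt, Option.some.injEq, app.injEq] at hg
      obtain ⟨rfl, -⟩ := hg
      exact absurd i.2 (by omega)
    | cons j p =>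
      rw [List.cons_prefix_cons] at hp
      obtain ⟨rfl, hp⟩ := hp
      exact Or.inr ⟨p, hp, g, as, by simpa [subtermAt] using hg, h0⟩

theorem not_determinedAt_nil_var (x : V) : ¬ (var x : Term ar V).DeterminedAt [] := by
  rintro (⟨f, args, h⟩ | ⟨p, hp, f, args, h, -⟩)
  · simp [subtermAt] at h
  · rw [List.prefix_nil] at hp
    subst hp
    simp [subtermAt] at h

end Term

/-! ### Automata: states of terms with variables, and heights of accepted terms -/

namespace DTA

variable {F Q V : Type*} {ar : F → ℕ}

/-- The state of a term with variables, the variable `x` being in state `C x`. -/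
def runVars (A : DTA ar Q) (C : V → Q) : Term ar V → Option Q
  | .var x => some (C x)
  | .app f args =>
      if h : ∀ i, (A.runVars C (args i)).isSome then
        A.δ f fun i => (A.runVars C (args i)).get (h i)
      else none

/-- The state of an instance does not depend on the solution, so it can be computed from the term
alone. -/
theorem run_subst {A : DTA ar Q} {C : V → Q} {φ : V → Term ar Empty}
    (hφ : ∀ x, φ x ∈ A.lang (C x)) (t : Term ar V) : A.run (t.subst φ) = A.runVars C t := by
  induction t with
  | var x => exact hφ x
  | app f args ih => simp only [Term.subst, run, runVars, ih]

theorem run_app_eq_some {A : DTA ar Q} {f : F} {args : Fin (ar f) → Term ar Empty} {q : Q} :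
    A.run (.app f args) = some q ↔ ∃ qs, (∀ i, A.run (args i) = some (qs i)) ∧ A.δ f qs = some q := by
  constructor
  · intro h
    simp only [run] at h
    split_ifs at h with h1
    exact ⟨_, fun i => by simp, h⟩
  · rintro ⟨qs, h, hq⟩
    simp only [run, h]
    simpa using hq

theorem runVars_app_eq_of_forall {A : DTA ar Q} {C : V → Q} {f : F}
    {args : Fin (ar f) → Term ar V} {qs : Fin (ar f) → Q}
    (h : ∀ i, A.runVars C (args i) = some (qs i)) :
    A.runVars C (.app f args) = A.δ f qs := by
  simp only [runVars, h]
  simp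

theorem runVars_app_eq_none {A : DTA ar Q} {C : V → Q} {f : F} {args : Fin (ar f) → Term ar V}
    {i : Fin (ar f)} (h : A.runVars C (args i) = none) : A.runVars C (.app f args) = none := by
  simp only [runVars]
  rw [dif_neg]
  intro h1
  simpa [h] using h1 i

/-- A natural number attached to states can be bounded by their number if every value is preceded
by all smaller ones. -/
theorem lt_card_of_descending [Finite Q] {m : Q → ℕ} {P : Q → Prop}
    (h : ∀ q n, P q → m q = n + 1 → ∃ q', P q' ∧ m q' = n) {q : Q} (hq : P q) :
    m q < Nat.card Q := by
  have key : ∀ n q, P q → m q = n → ∀ k ≤ n, ∃ q', m q' = k := by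
    intro n
    induction n with
    | zero => intro q _ hm k hk; exact ⟨q, by omega⟩
    | succ n ih =>
      intro q hq hm k hk
      rcases Nat.lt_or_ge n k with h1 | h1
      · exact ⟨q, by omega⟩
      · obtain ⟨q', hq', hm'⟩ := h q n hq hm
        exact ih q' hq' hm' k h1
  -- Each of the values `0, …, m q` is attained, and states with different values are different.
  choose g hg using fun k : Fin (m q + 1) => key (m q) q hq rfl k (by omega)
  have hinj : Function.Injective g := fun a b hab => by
    have := congrArg m hab
    rw [hg, hg] at this
    exact Fin.ext this
  have := Nat.card_le_card_of_injective g hinj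
  simp only [Nat.card_eq_fintype_card, Fintype.card_fin] at this
  omega

/-- Take `m q` to be the least height in the language. In a lowest term of height `n + 1`, some
argument state must have least height exactly `n`; otherwise, replacing all arguments by lowest
terms of their states would give a lower term. -/
theorem exists_mem_lang_height_lt [Finite Q] {A : DTA ar Q} {q : Q} (hq : (A.lang q).Nonempty) :
    ∃ t ∈ A.lang q, t.height < Nat.card Q := by
  classical
  let m : Q → ℕ := fun q => sInf (Term.height '' A.lang q)
  have hm : ∀ q, (A.lang q).Nonempty → ∃ t ∈ A.lang q, t.height = m q := fun q hq =>
    Nat.sInf_mem (hq.image Term.height)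
  have hle : ∀ q, ∀ t ∈ A.lang q, m q ≤ t.height := fun q t ht =>
    Nat.sInf_le (Set.mem_image_of_mem _ ht)
  obtain ⟨t, ht, h⟩ := hm q hq
  refine ⟨t, ht, h ▸ lt_card_of_descending (P := fun q => (A.lang q).Nonempty) ?_ hq⟩
  intro q n hq hn
  obtain ⟨t, ht, h⟩ := hm q hq
  cases t with
  | var x => exact x.elim
  | app f args =>
    obtain ⟨qs, hqs, hd⟩ := run_app_eq_some.1 ht
    choose ts hts hmin using fun i => hm (qs i) ⟨args i, hqs i⟩
    by_contra! hno
    have hlt : ∀ i, (ts i).height < n := fun i => by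
      have h1 := hle (qs i) (args i) (hqs i)
      have h2 := Term.height_lt_height_app f args i
      have h3 := hno (qs i) ⟨args i, hqs i⟩
      rw [hmin]
      omega
    have h4 := hle q (.app f ts) (run_app_eq_some.2 ⟨qs, hts, hd⟩)
    have h5 := Term.height_app_le hlt
    omega

/-- Take `m q` to be the greatest height in the finite language. In a highest term, follow an
argument of maximal height: plugging in other terms of its state is injective, so that language is
finite too, and a higher argument would give a higher term. -/
theorem height_lt_of_mem_lang [Finite Q] {A : DTA ar Q} {q : Q} (hq : (A.lang q).Finite)
    {t : Term ar Empty} (ht : t ∈ A.lang q) : t.height < Nat.card Q := by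
  classical
  let m : Q → ℕ := fun q => sSup (Term.height '' A.lang q)
  have hle : ∀ q, (A.lang q).Finite → ∀ t ∈ A.lang q, t.height ≤ m q := fun q hq t ht =>
    le_csSup (hq.image _).bddAbove (Set.mem_image_of_mem _ ht)
  refine (hle q hq t ht).trans_lt (lt_card_of_descending
    (P := fun q => (A.lang q).Finite ∧ (A.lang q).Nonempty) ?_ ⟨hq, t, ht⟩)
  rintro q n ⟨hq, hne⟩ hn
  obtain ⟨t, ht, h⟩ : m q ∈ Term.height '' A.lang q :=
    Nat.sSup_mem (hne.image _) (hq.image _).bddAbove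
  cases t with
  | var x => exact x.elim
  | app f args =>
    obtain ⟨qs, hqs, hd⟩ := run_app_eq_some.1 ht
    obtain ⟨i, hi⟩ := Term.exists_height_app_eq (h.trans hn)
    have hplug : ∀ r ∈ A.lang (qs i), Term.app f (Function.update args i r) ∈ A.lang q := by
      intro r hr
      refine run_app_eq_some.2 ⟨qs, fun j => ?_, hd⟩
      by_cases hj : j = i
      · subst hj; simpa using show A.run r = _ from hr
      · simpa [hj] using hqs j
    have hfin : (A.lang (qs i)).Finite := by
      refine Set.Finite.of_injOn (f := fun r => Term.app f (Function.update args i r))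
        hplug (fun a _ b _ hab => ?_) hq
      simp only [Term.app.injEq, heq_eq_eq, true_and] at hab
      exact Function.update_injective args i hab
    refine ⟨qs i, ⟨hfin, args i, hqs i⟩, le_antisymm ?_ (hi ▸ hle _ hfin _ (hqs i))⟩
    refine csSup_le ⟨_, Set.mem_image_of_mem _ (hqs i)⟩ ?_
    rintro _ ⟨r, hr, rfl⟩
    have h1 := hle q hq _ (hplug r hr)
    have h2 := Term.height_lt_height_app f (Function.update args i r) i
    simp only [Function.update_self] at h2
    omega

end DTA

/-! ### Simultaneous solvability of disequations -/

namespace RestrictedConstraint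

variable {F Q V : Type*} {ar : F → ℕ} {R : RestrictedConstraint ar Q V}

theorem exists_isSolution [Finite Q] (hne : ∀ q, (R.A.lang q).Nonempty) (hh : Nat.card Q ≤ R.h) :
    ∃ φ, R.IsSolution φ := by
  choose φ h1 h2 using fun x => DTA.exists_mem_lang_height_lt (hne (R.C x))
  exact ⟨φ, fun x => ⟨h1 x, fun _ => (h2 x).le.trans hh⟩⟩

theorem IsSolution.update [DecidableEq V] {φ : V → Term ar Empty} (hφ : R.IsSolution φ) {y : V}
    {a : Term ar Empty} (ha : a ∈ R.A.lang (R.C y)) (hy : y ∈ R.W → a.height ≤ R.h) :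
    R.IsSolution (Function.update φ y a) := by
  intro x
  by_cases hx : x = y
  · subst hx
    rw [Function.update_self]
    exact ⟨ha, hy⟩
  · rw [Function.update_of_ne hx]
    exact hφ x

/-- Finitely many disequations that are solvable one by one can be solved simultaneously, with
the values of the variables that have infinitely many values outside a given finite set. -/
theorem exists_isSolution_forall_ne [Finite V] {ι : Type*} [Fintype ι] {n : ℕ}
    (hι : Fintype.card ι ≤ n) (hA : R.A.IsOneOr (n + 1)) (hsol : ∃ φ, R.IsSolution φ)
    (u v : ι → Term ar V) (hu : ∀ i, (u i).AllVars (· ∉ R.W)) (hv : ∀ i, (v i).AllVars (· ∉ R.W))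
    (hne : ∀ i, ∃ φ, R.IsSolution φ ∧ (u i).subst φ ≠ (v i).subst φ)
    {B : Set (Term ar Empty)} (hB : B.Finite) :
    ∃ φ, R.IsSolution φ ∧ (∀ i, (u i).subst φ ≠ (v i).subst φ) ∧
      ∀ x, x ∉ R.W → (R.A.lang (R.C x)).Infinite → φ x ∉ B := by
  classical
  have := Fintype.ofFinite V
  -- Invariant: with the variables in `T` fixed by `φ`, each disequation is still solvable on its
  -- own, by some `ψ i` that agrees with `φ` on `T`. The `ψ i` need not agree elsewhere until `T`
  -- contains all variables.
  have key : ∀ T : Finset V, ∃ φ, R.IsSolution φ ∧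
      (∀ i, ∃ ψ, R.IsSolution ψ ∧ (∀ x ∈ T, ψ x = φ x) ∧ (u i).subst ψ ≠ (v i).subst ψ) ∧
      ∀ x ∈ T, x ∉ R.W → (R.A.lang (R.C x)).Infinite → φ x ∉ B := by
    intro T
    induction T using Finset.induction_on with
    | empty =>
      obtain ⟨φ, hφ⟩ := hsol
      refine ⟨φ, hφ, fun i => ?_, by simp⟩
      obtain ⟨ψ, h1, h2⟩ := hne i
      exact ⟨ψ, h1, by simp, h2⟩
    | insert y T hy ih =>
      obtain ⟨φ, hφ, hψ, hφB⟩ := ih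
      choose ψ hψs hψT hψne using hψ
      -- it suffices to find a value for `y`
      suffices h : ∃ a ∈ R.A.lang (R.C y), (y ∈ R.W → a.height ≤ R.h) ∧
          (∀ i, (u i).subst (Function.update (ψ i) y a) ≠
            (v i).subst (Function.update (ψ i) y a)) ∧
          (y ∉ R.W → (R.A.lang (R.C y)).Infinite → a ∉ B) by
        obtain ⟨a, ha, haW, hane, haB⟩ := h
        refine ⟨Function.update φ y a, hφ.update ha haW, fun i =>
          ⟨Function.update (ψ i) y a, (hψs i).update ha haW, fun x hx => ?_, hane i⟩, ?_⟩
        · by_cases hxy : x = y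
          · simp [hxy]
          · simpa [hxy] using hψT i x ((Finset.mem_insert.1 hx).resolve_left hxy)
        · intro x hx
          by_cases hxy : x = y
          · subst hxy
            simpa using haB
          · simpa [hxy] using hφB x ((Finset.mem_insert.1 hx).resolve_left hxy)
      by_cases hW : y ∈ R.W
      -- Variables of `W` do not occur in the disequations, so any admissible value is harmless.
      · refine ⟨φ y, (hφ y).1, (hφ y).2, fun i => ?_, fun h => (h hW).elim⟩
        have hc : ∀ x, x ∉ R.W → Function.update (ψ i) y (φ y) x = ψ i x := fun x hx => by
          rw [Function.update_of_ne]
          rintro rfl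
          exact hx hW
        rw [Term.subst_congr (hu i) hc, Term.subst_congr (hv i) hc]
        exact hψne i
      · by_cases h1 : (R.A.lang (R.C y)).encard = 1
        · refine ⟨φ y, (hφ y).1, fun h => (hW h).elim, fun i => ?_, fun _ h => ?_⟩
          · have : φ y = ψ i y :=
              Set.encard_le_one_iff.1 h1.le _ _ (hφ y).1 (hψs i y).1
            rw [this, Function.update_eq_self]
            exact hψne i
          · rw [← Set.encard_eq_top_iff, h1] at h
            simp at h
        -- With the remaining variables as in `ψ i`, at most one value of `y` makes the two sides
        -- equal: two such values would make them equal at `ψ i y` as well.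
        · have hbad : ∀ i, ∃ b, ∀ a, (u i).subst (Function.update (ψ i) y a) =
              (v i).subst (Function.update (ψ i) y a) → a = b := by
            intro i
            by_contra! hno
            obtain ⟨a, ha, -⟩ := hno (ψ i y)
            obtain ⟨b, hb, hab⟩ := hno a
            refine hψne i ?_
            have := Term.subst_update_eq_subst_update hab hb ha (ψ i y)
            rwa [Function.update_eq_self] at this
          choose b hb using hbad
          -- At least `n + 1` values against at most `n` bad ones; in the infinite case `B` can be
          -- removed as well.
          have hlarge := (hA (R.C y)).resolve_left h1
          have hrange : (Set.range b).encard ≤ n := by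
            rw [← Set.image_univ]
            refine (Set.encard_image_le _ _).trans ?_
            rw [Set.encard_univ, ENat.card_eq_coe_fintype_card]
            exact_mod_cast hι
          obtain ⟨a, ha, hab, haB⟩ : ∃ a ∈ R.A.lang (R.C y), a ∉ Set.range b ∧
              ((R.A.lang (R.C y)).Infinite → a ∉ B) := by
            by_cases hinf : (R.A.lang (R.C y)).Infinite
            · obtain ⟨a, ha, h⟩ := (hinf.sdiff ((Set.finite_range b).union hB)).nonempty
              exact ⟨a, ha, fun h' => h (Or.inl h'), fun _ h' => h (Or.inr h')⟩
            · obtain ⟨a, ha, h⟩ : ∃ a ∈ R.A.lang (R.C y), a ∉ Set.range b := by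
                by_contra! hsub
                have := hlarge.trans ((Set.encard_le_encard hsub).trans hrange)
                norm_cast at this
                omega
              exact ⟨a, ha, h, fun h' => (hinf h').elim⟩
          exact ⟨a, ha, fun h => (hW h).elim, fun i h => hab ⟨i, (hb i a h).symm⟩, fun _ => haB⟩
  obtain ⟨φ, hφ, hψ, hφB⟩ := key Finset.univ
  refine ⟨φ, hφ, fun i => ?_, fun x => hφB x (Finset.mem_univ x)⟩
  obtain ⟨ψ, -, h1, h2⟩ := hψ i
  rwa [funext fun x => h1 x (Finset.mem_univ x)] at h2

/-- A reason for which some solution of `R` violates `P`. -/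
def Refutable (R : RestrictedConstraint ar Q V) (P : (V → Term ar Empty) → Prop) : Prop :=
  (∀ φ, R.IsSolution φ → ¬ P φ) ∨
  (∃ y, y ∉ R.W ∧ (R.A.lang (R.C y)).Infinite ∧
    ∀ φ, R.IsSolution φ → P φ → (φ y).height ≤ R.h) ∨
  ∃ u v : Term ar V, u.AllVars (· ∉ R.W) ∧ v.AllVars (· ∉ R.W) ∧
    (∃ φ, R.IsSolution φ ∧ u.subst φ ≠ v.subst φ) ∧
    ∀ φ, R.IsSolution φ → P φ → u.subst φ = v.subst φ

theorem Refutable.mono {P P' : (V → Term ar Empty) → Prop} (h : R.Refutable P)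
    (hP : ∀ φ, R.IsSolution φ → P' φ → P φ) : R.Refutable P' := by
  rcases h with h | ⟨y, h1, h2, h3⟩ | ⟨u, v, h1, h2, h3, h4⟩
  · exact Or.inl fun φ hφ h' => h φ hφ (hP φ hφ h')
  · exact Or.inr (Or.inl ⟨y, h1, h2, fun φ hφ h' => h3 φ hφ (hP φ hφ h')⟩)
  · exact Or.inr (Or.inr ⟨u, v, h1, h2, h3, fun φ hφ h' => h4 φ hφ (hP φ hφ h')⟩)

/-- Of the three reasons in `Refutable`, the first needs no action, the second is met by giving `y`
a value of height above `h`, and the third is a solvable disequation. -/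
theorem exists_isSolution_forall_not [Finite F] [Finite V] {ι : Type*} [Finite ι]
    {n : ℕ} (hι : Nat.card ι ≤ n) (hA : R.A.IsOneOr (n + 1)) (hsol : ∃ φ, R.IsSolution φ)
    {P : ι → (V → Term ar Empty) → Prop} (hP : ∀ i, R.Refutable (P i))
    {B : Set (Term ar Empty)} (hB : B.Finite) :
    ∃ φ, R.IsSolution φ ∧ (∀ i, ¬ P i φ) ∧
      ∀ x, x ∉ R.W → (R.A.lang (R.C x)).Infinite → φ x ∉ B := by
  classical
  have := Fintype.ofFinite ι
  let J : Type _ := {i : ι // ∃ u v : Term ar V, u.AllVars (· ∉ R.W) ∧ v.AllVars (· ∉ R.W) ∧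
    (∃ φ, R.IsSolution φ ∧ u.subst φ ≠ v.subst φ) ∧
    ∀ φ, R.IsSolution φ → P i φ → u.subst φ = v.subst φ}
  choose u v hu hv hne huv using fun j : J => j.2
  have hJ : Fintype.card J ≤ n := by
    refine (Fintype.card_subtype_le _).trans ?_
    rwa [← Nat.card_eq_fintype_card]
  -- Over a finite signature only finitely many ground terms have height at most `h`, so they can be
  -- added to the values to be avoided.
  obtain ⟨φ, hφ, h1, h2⟩ := exists_isSolution_forall_ne hJ hA hsol u v hu hv hne
    (hB.union (Term.finite_setOf_height_lt (ar := ar) (R.h + 1)))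
  refine ⟨φ, hφ, fun i hi => ?_, fun x hx hinf hxB => h2 x hx hinf (Or.inl hxB)⟩
  rcases hP i with h | ⟨y, hy, hinf, h⟩ | h
  · exact h φ hφ hi
  · exact h2 y hy hinf (Or.inr (Nat.lt_succ_of_le (h φ hφ hi)))
  · exact h1 ⟨i, h⟩ (huv ⟨i, h⟩ φ hφ hi)

end RestrictedConstraint

/-! ### Matching by a worklist -/

namespace RestrictedConstraint

variable {F Q V : Type*} {ar : F → ℕ} {R : RestrictedConstraint ar Q V}

/-- The entries of the worklist: instances of `u` have to be matched by `t`, or the instances of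
`u` and `v` have to be equal. -/
inductive Item (ar : F → ℕ) (V : Type*) where
  | matching (t u : Term ar V) : Item ar V
  | equal (u v : Term ar V) : Item ar V

namespace Item

/-- A bound on the number of steps that are needed to process the item. -/
def weight : Item ar V → ℕ
  | matching _ u => 2 * u.size
  | equal _ v => v.size

def Holds (φ ψ : V → Term ar Empty) : Item ar V → Prop
  | matching t u => t.subst ψ = u.subst φ
  | equal u v => u.subst φ = v.subst φ

end Item

/-- The properties shared by the subterms of the term whose instances are to be matched. -/
def Good (R : RestrictedConstraint ar Q V) (u : Term ar V) : Prop :=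
  u.AllVars (· ∉ R.W) ∧ Nat.card Q + u.height ≤ R.h

/-- This is the test for binding a variable of `W` to `u`: it bounds the heights of all instances of
`u`, whereas a variable with infinite language and outside `W` makes them unbounded. -/
def FinVars (R : RestrictedConstraint ar Q V) (u : Term ar V) : Prop :=
  u.AllVars fun x => (R.A.lang (R.C x)).Finite

/-- `u` and `v` have the same instances since their states agree and have only one term. -/
def Forced (R : RestrictedConstraint ar Q V) (u v : Term ar V) : Prop :=
  ∃ q, R.A.runVars R.C u = some q ∧ R.A.runVars R.C v = some q ∧ (R.A.lang q).encard = 1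

def Item.Good (R : RestrictedConstraint ar Q V) : Item ar V → Prop
  | matching t u => (∀ r ∈ t.nonvarPos, u.DeterminedAt r) ∧ R.Good u
  | equal u v => R.Good u ∧ R.Good v

/-- Bindings made so far of the variables of the matching term. -/
abbrev Env (ar : F → ℕ) (V : Type*) := V → Option (Term ar V)

/-- These are the conditions under which the instance of a bound term is an admissible value of the
variable bound to it. -/
def EnvGood (R : RestrictedConstraint ar Q V) (e : Env ar V) : Prop :=
  ∀ x u, e x = some u →
    R.Good u ∧ R.A.runVars R.C u = some (R.C x) ∧ (x ∈ R.W → R.FinVars u)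

/-- Some solution `ψ` makes all bindings and items true. -/
def Solves (R : RestrictedConstraint ar Q V) (e : Env ar V) (L : List (Item ar V))
    (φ : V → Term ar Empty) : Prop :=
  ∃ ψ, R.IsSolution ψ ∧ (∀ x u, e x = some u → ψ x = u.subst φ) ∧ ∀ i ∈ L, i.Holds φ ψ

open Classical in
/-- Processing an item changes the bindings and replaces it by other items. -/
inductive Step (R : RestrictedConstraint ar Q V) (e : Env ar V) :
    Item ar V → Env ar V → List (Item ar V) → Prop
  | forced (u v : Term ar V) (h : R.Forced u v) : Step R e (.equal u v) e []
  | eqVar (x : V) : Step R e (.equal (.var x) (.var x)) e []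
  | eqApp (f : F) (args args' : Fin (ar f) → Term ar V)
      (h : ¬ R.Forced (.app f args) (.app f args')) :
      Step R e (.equal (.app f args) (.app f args')) e
        (List.ofFn fun i => .equal (args i) (args' i))
  | matchApp (f : F) (args args' : Fin (ar f) → Term ar V) :
      Step R e (.matching (.app f args) (.app f args')) e
        (List.ofFn fun i => .matching (args i) (args' i))
  | bind (x : V) (u : Term ar V) (hr : R.A.runVars R.C u = some (R.C x))
      (hW : x ∈ R.W → R.FinVars u) (he : e x = none) :
      Step R e (.matching (.var x) u) (Function.update e x (some u)) []
  | bound (x : V) (u u' : Term ar V) (hr : R.A.runVars R.C u = some (R.C x))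
      (hW : x ∈ R.W → R.FinVars u) (he : e x = some u') :
      Step R e (.matching (.var x) u) e [.equal u' u]

/-- The item can be violated. -/
inductive Clash (R : RestrictedConstraint ar Q V) : Item ar V → Prop
  | eqVarLeft (x : V) (v : Term ar V) (h : ¬ R.Forced (.var x) v) (hv : v ≠ .var x) :
      Clash R (.equal (.var x) v)
  | eqVarRight (x : V) (f : F) (args : Fin (ar f) → Term ar V)
      (h : ¬ R.Forced (.app f args) (.var x)) : Clash R (.equal (.app f args) (.var x))
  | eqApp (f g : F) (args : Fin (ar f) → Term ar V) (args' : Fin (ar g) → Term ar V)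
      (h : ¬ R.Forced (.app f args) (.app g args')) (hfg : f ≠ g) :
      Clash R (.equal (.app f args) (.app g args'))
  | matchApp (f g : F) (args : Fin (ar f) → Term ar V) (args' : Fin (ar g) → Term ar V)
      (hfg : f ≠ g) : Clash R (.matching (.app f args) (.app g args'))
  | matchState (x : V) (u : Term ar V) (h : R.A.runVars R.C u ≠ some (R.C x)) :
      Clash R (.matching (.var x) u)
  | matchHeight (x : V) (u : Term ar V) (hx : x ∈ R.W) (h : ¬ R.FinVars u) :
      Clash R (.matching (.var x) u)

/-- The only combination that is neither a step nor a clash, an application to be matched against a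
variable, contradicts determinedness at the root. -/
theorem step_or_clash {e : Env ar V} {i : Item ar V} (hi : i.Good R) :
    (∃ e' L, R.Step e i e' L) ∨ R.Clash i := by
  cases i with
  | equal u v =>
    by_cases h : R.Forced u v
    · exact Or.inl ⟨_, _, .forced u v h⟩
    cases u with
    | var x =>
      by_cases hv : v = .var x
      · subst hv
        exact Or.inl ⟨_, _, .eqVar x⟩
      · exact Or.inr (.eqVarLeft x v h hv)
    | app f args =>
      cases v with
      | var x => exact Or.inr (.eqVarRight x f args h)
      | app g args' =>
        by_cases hfg : f = g
        · subst hfg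
          exact Or.inl ⟨_, _, .eqApp f args args' h⟩
        · exact Or.inr (.eqApp f g args args' h hfg)
  | matching t u =>
    cases t with
    | var x =>
      by_cases hr : R.A.runVars R.C u = some (R.C x)
      · by_cases hW : x ∈ R.W → R.FinVars u
        · cases he : e x with
          | none => exact Or.inl ⟨_, _, .bind x u hr hW he⟩
          | some u' => exact Or.inl ⟨_, _, .bound x u u' hr hW he⟩
        · rw [Classical.not_imp] at hW
          exact Or.inr (.matchHeight x u hW.1 hW.2)
      · exact Or.inr (.matchState x u hr)
    | app f args =>
      cases u with
      | var x =>
        exact (Term.not_determinedAt_nil_var x (hi.1 [] ⟨f, args, by simp [Term.subtermAt]⟩)).elim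
      | app g args' =>
        by_cases hfg : f = g
        · subst hfg
          exact Or.inl ⟨_, _, .matchApp f args args'⟩
        · exact Or.inr (.matchApp f g args args' hfg)

/-- An equation is weighed by its right side only, because `bound` produces `.equal u' u` with an
older binding `u'` of unrelated size. The factor `2` on matching items pays for this later
comparison with `u`. -/
theorem Step.weight_lt {e e' : Env ar V} {i : Item ar V} {L : List (Item ar V)}
    (h : R.Step e i e' L) : (L.map Item.weight).sum + 1 ≤ i.weight := by
  cases h with
  | forced u v h => simpa [Item.weight] using Nat.succ_le_of_lt v.size_pos
  | eqVar x => simp [Item.weight, Term.size]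
  | eqApp f args args' h =>
    simp only [Item.weight, List.map_ofFn, List.sum_ofFn, Term.size, Function.comp_def]
    omega
  | matchApp f args args' =>
    simp only [Item.weight, List.map_ofFn, List.sum_ofFn, Term.size, Function.comp_def,
      ← Finset.mul_sum]
    omega
  | bind x u =>
    have := u.size_pos
    simp only [Item.weight, List.map_nil, List.sum_nil]
    omega
  | bound x u =>
    have := u.size_pos
    simp only [Item.weight, List.map_cons, List.map_nil, List.sum_cons, List.sum_nil]
    omega

theorem Good.arg {f : F} {args : Fin (ar f) → Term ar V} (h : R.Good (.app f args))
    (i : Fin (ar f)) : R.Good (args i) := by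
  refine ⟨h.1 i, ?_⟩
  have h1 := h.2
  have h2 := Term.height_lt_height_app f args i
  omega

open Classical in
theorem Step.good {e e' : Env ar V} {i : Item ar V} {L : List (Item ar V)}
    (h : R.Step e i e' L) (he : R.EnvGood e) (hi : i.Good R) :
    R.EnvGood e' ∧ ∀ j ∈ L, j.Good R := by
  cases h with
  | forced u v h => exact ⟨he, by simp⟩
  | eqVar x => exact ⟨he, by simp⟩
  | eqApp f args args' h =>
    refine ⟨he, fun j hj => ?_⟩
    obtain ⟨k, rfl⟩ := List.mem_ofFn.1 hj
    exact ⟨hi.1.arg k, hi.2.arg k⟩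
  | matchApp f args args' =>
    refine ⟨he, fun j hj => ?_⟩
    obtain ⟨k, rfl⟩ := List.mem_ofFn.1 hj
    exact ⟨Term.determinedAt_args hi.1 k, hi.2.arg k⟩
  | bind x u hr hW hx =>
    refine ⟨fun y w hw => ?_, by simp⟩
    by_cases hy : y = x
    · subst hy
      simp only [Function.update_self, Option.some.injEq] at hw
      subst hw
      exact ⟨hi.2, hr, hW⟩
    · rw [Function.update_of_ne hy] at hw
      exact he y w hw
  | bound x u u' hr hW hx =>
    refine ⟨he, fun j hj => ?_⟩
    rw [List.mem_singleton] at hj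
    subst hj
    exact ⟨(he x u' hx).1, hi.2⟩

theorem IsSolution.mem_lang {φ : V → Term ar Empty} (hφ : R.IsSolution φ) (x : V) :
    φ x ∈ R.A.lang (R.C x) := (hφ x).1

theorem IsSolution.run_subst {φ : V → Term ar Empty} (hφ : R.IsSolution φ) (u : Term ar V) :
    R.A.run (u.subst φ) = R.A.runVars R.C u :=
  DTA.run_subst hφ.mem_lang u

theorem Forced.subst_eq {u v : Term ar V} (h : R.Forced u v) {φ : V → Term ar Empty}
    (hφ : R.IsSolution φ) : u.subst φ = v.subst φ := by
  obtain ⟨q, hu, hv, hq⟩ := h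
  refine Set.encard_le_one_iff.1 hq.le _ _ ?_ ?_
  · exact (hφ.run_subst u).trans hu
  · exact (hφ.run_subst v).trans hv

-- The same `ψ` serves on both sides. A binding records the value of `ψ x`, so a second occurrence
-- of `x` amounts to an equation between instances under `φ`; a forced equation holds because `φ` is
-- a solution.
open Classical in
theorem Step.solves_iff {e e' : Env ar V} {i : Item ar V} {L : List (Item ar V)}
    (h : R.Step e i e' L) {φ : V → Term ar Empty} (hφ : R.IsSolution φ) (L' : List (Item ar V)) :
    R.Solves e (i :: L') φ ↔ R.Solves e' (L ++ L') φ := by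
  unfold Solves
  refine exists_congr fun ψ => and_congr_right fun hψ => ?_
  simp only [List.forall_mem_cons, List.forall_mem_append]
  rw [← and_assoc, ← and_assoc]
  refine and_congr_left fun _ => ?_
  cases h with
  | forced u v h => simp [Item.Holds, h.subst_eq hφ]
  | eqVar x => simp [Item.Holds]
  | eqApp f args args' h =>
    simp [Item.Holds, Term.subst, funext_iff]
  | matchApp f args args' =>
    simp [Item.Holds, Term.subst, funext_iff]
  | bind x u hr hW hx =>
    simp only [Item.Holds, List.not_mem_nil, false_imp_iff, implies_true, and_true]
    constructor
    · rintro ⟨h1, h2⟩ y w hw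
      by_cases hy : y = x
      · subst hy
        simp only [Function.update_self, Option.some.injEq] at hw
        rw [← hw]
        exact h2
      · rw [Function.update_of_ne hy] at hw
        exact h1 y w hw
    · intro h1
      refine ⟨fun y w hw => h1 y w ?_, h1 x u (by simp)⟩
      rwa [Function.update_of_ne]
      rintro rfl
      rw [hx] at hw
      cases hw
  | bound x u u' hr hW hx =>
    simp only [Item.Holds, Term.subst, List.mem_singleton, forall_eq]
    refine and_congr_right fun h1 => ?_
    rw [h1 x u' hx]

/-- If `x` has a single value and equality always held, then `v` would have state `C x` and the
equation would be forced. Otherwise `x` has two values, since `n + 2 ≥ 2`, and the occurs check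
allows only one of them to satisfy the equation. -/
theorem exists_subst_ne_of_ne_var {n : ℕ} (hA : R.A.IsOneOr (n + 2)) (hsol : ∃ φ, R.IsSolution φ)
    {x : V} (hx : x ∉ R.W) {v : Term ar V} (h : ¬ R.Forced (.var x) v) (hv : v ≠ .var x) :
    ∃ φ, R.IsSolution φ ∧ (Term.var x).subst φ ≠ v.subst φ := by
  classical
  obtain ⟨φ, hφ⟩ := hsol
  by_contra! hno
  by_cases h1 : (R.A.lang (R.C x)).encard = 1
  · refine h ⟨R.C x, rfl, ?_, h1⟩
    rw [← hφ.run_subst v, ← hno φ hφ]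
    exact hφ.mem_lang x
  · have h2 := (hA (R.C x)).resolve_left h1
    have h3 : 1 < (R.A.lang (R.C x)).encard :=
      lt_of_lt_of_le (by norm_cast; omega) h2
    obtain ⟨a, b, ha, hb, hab⟩ := Set.one_lt_encard_iff.1 h3
    have key : ∀ a ∈ R.A.lang (R.C x), a = v.subst (Function.update φ x a) := fun a ha => by
      have := hno _ (hφ.update ha fun h => (hx h).elim)
      simpa [Term.subst] using this
    exact hab (Term.eq_of_eq_subst_update hv (key a ha) (key b hb))

/-- Clashes of symbols or states exclude every solution. A clash at a variable of `W` bounds the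
height of a variable with infinite language. A clash of an equation with a variable on one side is a
violable equation. -/
theorem Clash.refutable [Finite Q] {n : ℕ} (hA : R.A.IsOneOr (n + 2))
    (hsol : ∃ φ, R.IsSolution φ) {e : Env ar V} {i : Item ar V} (h : R.Clash i) (hi : i.Good R)
    (L : List (Item ar V)) : R.Refutable (R.Solves e (i :: L)) := by
  have holds : ∀ {φ}, R.Solves e (i :: L) φ → ∃ ψ, R.IsSolution ψ ∧ i.Holds φ ψ :=
    fun ⟨ψ, h1, _, h2⟩ => ⟨ψ, h1, h2 i (by simp)⟩
  cases h with
  | eqVarLeft x v h hv =>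
    refine Or.inr (Or.inr ⟨_, _, hi.1.1, hi.2.1,
      exists_subst_ne_of_ne_var hA hsol hi.1.1 h hv, fun φ _ hs => ?_⟩)
    obtain ⟨ψ, -, h⟩ := holds hs
    exact h
  | eqVarRight x f args h =>
    refine Or.inr (Or.inr ⟨_, _, hi.2.1, hi.1.1,
      exists_subst_ne_of_ne_var hA hsol hi.2.1 (v := .app f args) (fun ⟨q, h1, h2, h3⟩ =>
        h ⟨q, h2, h1, h3⟩) (by simp), fun φ _ hs => ?_⟩)
    obtain ⟨ψ, -, h⟩ := holds hs
    exact h.symm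
  | eqApp f g args args' h hfg =>
    refine Or.inl fun φ _ hs => ?_
    obtain ⟨ψ, -, h⟩ := holds hs
    simp only [Item.Holds, Term.subst, Term.app.injEq] at h
    exact hfg h.1
  | matchApp f g args args' hfg =>
    refine Or.inl fun φ _ hs => ?_
    obtain ⟨ψ, -, h⟩ := holds hs
    simp only [Item.Holds, Term.subst, Term.app.injEq] at h
    exact hfg h.1
  | matchState x u h =>
    refine Or.inl fun φ hφ hs => ?_
    obtain ⟨ψ, hψ, h'⟩ := holds hs
    rw [← hφ.run_subst u, ← h'] at h
    exact h (hψ.mem_lang x)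
  | matchHeight x u hx h =>
    obtain ⟨y, h1, h2, h3⟩ := Term.exists_height_le_of_not_allVars hi.2.1 h
    refine Or.inr (Or.inl ⟨y, h2, h1, fun φ hφ hs => (h3 φ).trans ?_⟩)
    obtain ⟨ψ, hψ, h'⟩ := holds hs
    rw [← h']
    exact (hψ x).2 hx

/-- Give each bound variable the instance of its term and leave the others at their value under `φ`.
On `W` the bound terms have only variables with finite languages, whose values have height below
`|Q|`; hence the height is at most `height(u) + |Q| ≤ h`. -/
theorem EnvGood.solves_nil [Finite Q] {e : Env ar V} (he : R.EnvGood e) {φ : V → Term ar Empty}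
    (hφ : R.IsSolution φ) : R.Solves e [] φ := by
  refine ⟨fun x => (e x).elim (φ x) (·.subst φ), fun x => ?_, fun x u hu => by simp [hu], by simp⟩
  cases hu : e x with
  | none => simpa [hu] using hφ x
  | some u =>
    obtain ⟨h1, h2, h3⟩ := he x u hu
    simp only [hu, Option.elim_some]
    refine ⟨(hφ.run_subst u).trans h2, fun hW => ?_⟩
    have h4 := Term.height_subst_le (h3 hW) (φ := φ) (n := Nat.card Q)
      fun y hy => (DTA.height_lt_of_mem_lang hy (hφ.mem_lang y)).le
    have h5 := h1.2
    omega

/-- Steps preserve solvability for each fixed `φ` and decrease the total weight, so the worklist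
ends in a clash or becomes empty. No choices are made on the way, which is why failure for some
solution always comes with a reason usable in `exists_isSolution_forall_not`. -/
theorem refutable_or_forall_solves [Finite Q] {n : ℕ} (hA : R.A.IsOneOr (n + 2))
    (hsol : ∃ φ, R.IsSolution φ) {e : Env ar V} {L : List (Item ar V)} (he : R.EnvGood e)
    (hL : ∀ i ∈ L, i.Good R) :
    R.Refutable (R.Solves e L) ∨ ∀ φ, R.IsSolution φ → R.Solves e L φ := by
  induction hN : (L.map Item.weight).sum using Nat.strong_induction_on generalizing e L with
  | _ N ih =>
  cases L with
  | nil => exact Or.inr fun φ hφ => he.solves_nil hφ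
  | cons i L =>
    simp only [List.mem_cons, forall_eq_or_imp] at hL
    rcases step_or_clash (e := e) hL.1 with ⟨e', L', h⟩ | h
    · obtain ⟨he', hL'⟩ := h.good he hL.1
      have hw := h.weight_lt
      rcases ih ((L' ++ L).map Item.weight).sum (by simp at hN ⊢; omega) he' (L := L' ++ L)
        (fun j hj => (List.mem_append.1 hj).elim (hL' j) (hL.2 j)) rfl with h1 | h1
      · exact Or.inl (h1.mono fun φ hφ => (h.solves_iff hφ L).1)
      · exact Or.inr fun φ hφ => (h.solves_iff hφ L).2 (h1 φ hφ)
    · exact Or.inl (h.refutable hA hsol hL.1 L)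

end RestrictedConstraint

/-! ### Execution of loops with loop-free bodies, and the layout of the memory -/

namespace RAM

/-- `Function.update` for memories. -/
def upd (f : ℕ → ℕ) (i x n : ℕ) : ℕ := if n = i then x else f n

theorem upd_eq_update (f : ℕ → ℕ) (i x : ℕ) : upd f i x = Function.update f i x := by
  funext n
  rw [upd, Function.update_apply]

@[simp] theorem upd_self (f : ℕ → ℕ) (i x : ℕ) : upd f i x i = x := if_pos rfl

@[simp] theorem upd_of_ne {i n : ℕ} (h : n ≠ i) (f : ℕ → ℕ) (x : ℕ) : upd f i x n = f n := if_neg h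

namespace Prog

/-- The effect of a program without loops. -/
def apply (I : ℕ → ℕ) : Prog → (ℕ → ℕ) → (ℕ → ℕ)
  | store a e, M => upd M (a.eval I M) (e.eval I M)
  | seq p q, M => q.apply I (p.apply I M)
  | cond e p q, M => if e.eval I M = 0 then q.apply I M else p.apply I M
  | loop _ _, M => M

def LoopFree : Prog → Prop
  | store _ _ => True
  | seq p q => p.LoopFree ∧ q.LoopFree
  | cond _ p q => p.LoopFree ∧ q.LoopFree
  | loop _ _ => False

/-- A bound on the number of steps of a program without loops. -/
def maxCost : Prog → ℕ
  | store a e => a.cost + e.cost + 1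
  | seq p q => p.maxCost + q.maxCost
  | cond e p q => e.cost + 1 + p.maxCost + q.maxCost
  | loop _ _ => 0

theorem LoopFree.exec {p : Prog} (hp : p.LoopFree) (I M : ℕ → ℕ) :
    ∃ n ≤ p.maxCost, Exec I p M (p.apply I M) n := by
  induction p generalizing M with
  | store a e => exact ⟨_, le_rfl, by rw [apply, upd_eq_update]; exact .store a e M⟩
  | seq p q ihp ihq =>
    obtain ⟨m, hm, h1⟩ := ihp hp.1 M
    obtain ⟨n, hn, h2⟩ := ihq hp.2 (p.apply I M)
    exact ⟨m + n, Nat.add_le_add hm hn, .seq h1 h2⟩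
  | cond e p q ihp ihq =>
    by_cases he : e.eval I M = 0
    · obtain ⟨n, hn, h⟩ := ihq hp.2 M
      refine ⟨e.cost + 1 + n, by simp only [maxCost]; omega, ?_⟩
      simp only [apply, if_pos he]
      exact .condFalse he h
    · obtain ⟨n, hn, h⟩ := ihp hp.1 M
      refine ⟨e.cost + 1 + n, by simp only [maxCost]; omega, ?_⟩
      simp only [apply, if_neg he]
      exact .condTrue he h
  | loop e p => exact hp.elim

end Prog

/-- `n` rounds of `loop e p` lead from the first to the second memory, `p` having no loops. -/
inductive Rounds (I : ℕ → ℕ) (e : Expr) (p : Prog) : ℕ → (ℕ → ℕ) → (ℕ → ℕ) → Prop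
  | zero (M : ℕ → ℕ) : Rounds I e p 0 M M
  | succ {n : ℕ} {M M' : ℕ → ℕ} (he : e.eval I M ≠ 0) (h : Rounds I e p n (p.apply I M) M') :
      Rounds I e p (n + 1) M M'

namespace Rounds

variable {I : ℕ → ℕ} {e : Expr} {p : Prog}

theorem trans {m n : ℕ} {M M' M'' : ℕ → ℕ} (h : Rounds I e p m M M')
    (h' : Rounds I e p n M' M'') : Rounds I e p (m + n) M M'' := by
  induction h with
  | zero M => rwa [Nat.zero_add]
  | succ he h ih =>
    rw [Nat.add_right_comm]
    exact .succ he (ih h')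

theorem single {M : ℕ → ℕ} (he : e.eval I M ≠ 0) : Rounds I e p 1 M (p.apply I M) :=
  .succ he (.zero _)

theorem exec (hp : p.LoopFree) {n : ℕ} {M M' : ℕ → ℕ} (h : Rounds I e p n M M')
    (hM' : e.eval I M' = 0) :
    ∃ m ≤ n * (e.cost + 1 + p.maxCost) + (e.cost + 1), Exec I (.loop e p) M M' m := by
  induction h with
  | zero M => exact ⟨e.cost + 1, by simp, .loopFalse hM'⟩
  | @succ n M M' he h ih =>
    obtain ⟨m, hm, h1⟩ := ih hM'
    obtain ⟨k, hk, h2⟩ := hp.exec I M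
    refine ⟨e.cost + 1 + k + m, ?_, .loopTrue he h2 h1⟩
    rw [Nat.add_mul, Nat.one_mul]
    omega

end Rounds

/-- A work memory organized as three registers, four tables and a stack of triples. -/
structure St where
  ans : ℕ
  sp : ℕ
  k : ℕ
  run : ℕ → ℕ
  inf : ℕ → ℕ
  vtab : ℕ → ℕ
  vtag : ℕ → ℕ
  sa : ℕ → ℕ
  sb : ℕ → ℕ
  kd : ℕ → ℕ

namespace St

/-- Registers are at addresses `0`, `8`, `16`; the tables and the stack components are
interleaved. -/
def enc (s : St) (n : ℕ) : ℕ :=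
  match n % 8 with
  | 0 => if n = 0 then s.ans else if n = 8 then s.sp else if n = 16 then s.k else 0
  | 1 => s.run (n / 8)
  | 2 => s.inf (n / 8)
  | 3 => s.vtab (n / 8)
  | 4 => s.vtag (n / 8)
  | 5 => s.sa (n / 8)
  | 6 => s.sb (n / 8)
  | 7 => s.kd (n / 8)
  | _ => 0

variable (s : St) (i x : ℕ)

@[simp] theorem enc_ans : s.enc 0 = s.ans := rfl
@[simp] theorem enc_sp : s.enc 8 = s.sp := rfl
@[simp] theorem enc_k : s.enc 16 = s.k := rfl

theorem lane_div {i l : ℕ} (h : l < 8) : (8 * i + l) / 8 = i := by omega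

@[simp] theorem enc_run : s.enc (8 * i + 1) = s.run i := by
  simp [enc, lane_div]
@[simp] theorem enc_inf : s.enc (8 * i + 2) = s.inf i := by
  simp [enc, lane_div]
@[simp] theorem enc_vtab : s.enc (8 * i + 3) = s.vtab i := by
  simp [enc, lane_div]
@[simp] theorem enc_vtag : s.enc (8 * i + 4) = s.vtag i := by
  simp [enc, lane_div]
@[simp] theorem enc_sa : s.enc (8 * i + 5) = s.sa i := by
  simp [enc, lane_div]
@[simp] theorem enc_sb : s.enc (8 * i + 6) = s.sb i := by
  simp [enc, lane_div]
@[simp] theorem enc_kd : s.enc (8 * i + 7) = s.kd i := by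
  simp [enc, lane_div]

@[simp] theorem update_ans : upd s.enc 0 x = enc { s with ans := x } := by
  funext n
  by_cases hn : n = 0
  · subst hn; rfl
  · rw [upd_of_ne hn]
    simp only [enc, if_neg hn]

@[simp] theorem update_sp : upd s.enc 8 x = enc { s with sp := x } := by
  funext n
  by_cases hn : n = 8
  · subst hn; rfl
  · rw [upd_of_ne hn]
    simp only [enc, if_neg hn]

@[simp] theorem update_k : upd s.enc 16 x = enc { s with k := x } := by
  funext n
  by_cases hn : n = 16
  · subst hn; rfl
  · rw [upd_of_ne hn]
    simp only [enc, if_neg hn]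

theorem update_lane {l : ℕ} {s' : St} (h1 : s'.enc (8 * i + l) = x)
    (h2 : ∀ n, (n % 8 ≠ l ∨ n / 8 ≠ i) → s'.enc n = s.enc n) :
    upd s.enc (8 * i + l) x = s'.enc := by
  funext n
  by_cases hn : n = 8 * i + l
  · subst hn; rw [upd_self, h1]
  · rw [upd_of_ne hn, h2]
    omega

@[simp] theorem update_run : upd s.enc (8 * i + 1) x =
    enc { s with run := upd s.run i x } := by
  refine update_lane s i x (by simp) fun n hn => ?_
  unfold enc
  split <;> first | rfl | exact upd_of_ne (by omega) _ _

@[simp] theorem update_inf : upd s.enc (8 * i + 2) x =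
    enc { s with inf := upd s.inf i x } := by
  refine update_lane s i x (by simp) fun n hn => ?_
  unfold enc
  split <;> first | rfl | exact upd_of_ne (by omega) _ _

@[simp] theorem update_vtab : upd s.enc (8 * i + 3) x =
    enc { s with vtab := upd s.vtab i x } := by
  refine update_lane s i x (by simp) fun n hn => ?_
  unfold enc
  split <;> first | rfl | exact upd_of_ne (by omega) _ _

@[simp] theorem update_vtag : upd s.enc (8 * i + 4) x =
    enc { s with vtag := upd s.vtag i x } := by
  refine update_lane s i x (by simp) fun n hn => ?_
  unfold enc
  split <;> first | rfl | exact upd_of_ne (by omega) _ _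

@[simp] theorem update_sa : upd s.enc (8 * i + 5) x =
    enc { s with sa := upd s.sa i x } := by
  refine update_lane s i x (by simp) fun n hn => ?_
  unfold enc
  split <;> first | rfl | exact upd_of_ne (by omega) _ _

@[simp] theorem update_sb : upd s.enc (8 * i + 6) x =
    enc { s with sb := upd s.sb i x } := by
  refine update_lane s i x (by simp) fun n hn => ?_
  unfold enc
  split <;> first | rfl | exact upd_of_ne (by omega) _ _

@[simp] theorem update_kd : upd s.enc (8 * i + 7) x =
    enc { s with kd := upd s.kd i x } := by
  refine update_lane s i x (by simp) fun n hn => ?_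
  unfold enc
  split <;> first | rfl | exact upd_of_ne (by omega) _ _

@[simp] theorem update_sa_zero : upd s.enc 5 x =
    enc { s with sa := upd s.sa 0 x } := update_sa s 0 x
@[simp] theorem update_sb_zero : upd s.enc 6 x =
    enc { s with sb := upd s.sb 0 x } := update_sb s 0 x
@[simp] theorem update_kd_zero : upd s.enc 7 x =
    enc { s with kd := upd s.kd 0 x } := update_kd s 0 x

def zero : St := ⟨0, 0, 0, 0, 0, 0, 0, 0, 0, 0⟩

theorem enc_zero : zero.enc = fun _ => 0 := by
  funext n
  simp only [enc, zero, ite_self, Pi.zero_apply]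
  split <;> rfl

end St

namespace Expr

/-- The address of entry `e` of lane `l`. -/
def cell (l : ℕ) (e : Expr) : Expr :=
  add (add (add (add e e) (add e e)) (add (add e e) (add e e))) (lit l)

@[simp] theorem eval_cell (I M : ℕ → ℕ) (l : ℕ) (e : Expr) :
    (cell l e).eval I M = 8 * e.eval I M + l := by
  simp only [cell, eval]
  omega

/-- Nonzero iff the values of `a` and `b` are different. -/
def neq (a b : Expr) : Expr := add (sub a b) (sub b a)

def spE : Expr := work (lit 8)
def kE : Expr := work (lit 16)
def runE (a : Expr) : Expr := work (cell 1 a)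
def infE (a : Expr) : Expr := work (cell 2 a)
def vtabE (a : Expr) : Expr := work (cell 3 a)
def vtagE (a : Expr) : Expr := work (cell 4 a)
def saE (a : Expr) : Expr := work (cell 5 a)
def sbE (a : Expr) : Expr := work (cell 6 a)
def kdE (a : Expr) : Expr := work (cell 7 a)

/-- Entry `e` of the array whose base address is in input cell `n`. -/
def arr (n : ℕ) (e : Expr) : Expr := input (add (input (lit n)) e)

/-- Field `n` of the node at address `a`. -/
def field (a : Expr) (n : ℕ) : Expr := input (add a (lit n))

end Expr

/-! ### The program -/

open RAM.Expr RAM.Prog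

def skip : Prog := store (lit 0) (work (lit 0))

/-! Computation of the states of the subterms of `s`, and of their variables with infinitely many
values. An undefined state is coded as `1`, the state `q` as `2` plus its name. -/

/-- The node at the top of the stack. -/
def topE : Expr := saE (sub spE (lit 1))

def push (e : Expr) : Prog :=
  seq (store (cell 5 spE) e) (store (lit 8) (add spE (lit 1)))

def finish (r i : Expr) : Prog :=
  seq (store (cell 1 topE) r) (seq (store (cell 2 topE) i) (store (lit 8) (sub spE (lit 1))))

/-- Transition entries are `0` or `1 +` a name, table entries are `1` or `2 +` a name. Thus `1` is
added to the entry read, `2` is subtracted before a state is used as an index, and subtracting `1`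
tests whether a state is defined. -/
def visitOne : Prog :=
  cond (sub (runE (field topE 2)) (lit 1))
    (finish (add (input (add (arr 3 (field topE 1)) (sub (runE (field topE 2)) (lit 2)))) (lit 1))
      (infE (field topE 2)))
    (finish (lit 1) (infE (field topE 2)))

def visitTwo : Prog :=
  cond (sub (runE (field topE 2)) (lit 1))
    (cond (sub (runE (field topE 3)) (lit 1))
      (finish
        (add (input (add (input (add (arr 3 (field topE 1))
          (sub (runE (field topE 2)) (lit 2)))) (sub (runE (field topE 3)) (lit 2)))) (lit 1))
        (add (infE (field topE 2)) (infE (field topE 3))))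
      (finish (lit 1) (add (infE (field topE 2)) (infE (field topE 3)))))
    (finish (lit 1) (add (infE (field topE 2)) (infE (field topE 3))))

/-- One round of a postorder traversal. Codes of states are positive, so a zero entry marks a node
that has not been evaluated, and no separate record of the children already treated is kept. -/
def visit : Prog :=
  cond (input topE)
    (cond (sub (input topE) (lit 1))
      (cond (sub (input topE) (lit 2))
        (cond (runE (field topE 2))
          (cond (runE (field topE 3)) visitTwo (push (field topE 3)))
          (push (field topE 2)))
        (cond (runE (field topE 2)) visitOne (push (field topE 2))))
      (finish (add (arr 3 (field topE 1)) (lit 1)) (lit 0)))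
    (finish (add (arr 4 (field topE 1)) (lit 2)) (arr 7 (arr 4 (field topE 1))))

/-! The worklist. -/

/-- Go on to the next element of `S`. -/
def next : Prog :=
  seq (store (lit 16) (sub kE (lit 1)))
    -- With `k` already decreased, the answer becomes `1` exactly when no element of `S` is left.
    -- The loop then stops, so the pair stored afterwards is irrelevant.
    (seq (store (lit 0) (sub (lit 1) kE))
      (seq (store (cell 5 (lit 0)) (arr 2 (sub kE (lit 1))))
        (seq (store (cell 6 (lit 0)) (input (lit 0)))
          (seq (store (cell 7 (lit 0)) (lit 0)) (store (lit 8) (lit 1))))))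

/-- Replace the item in the cell after the top of the stack by the items for the children. -/
def pushArgs : Prog :=
  cond (sub (input (saE spE)) (lit 1))
    (cond (sub (input (saE spE)) (lit 2))
      -- The first children go on top of the second ones, in the order of the list of items. The
      -- upper cell is filled first, since the lower one still holds the parents.
      (seq (store (cell 5 (add spE (lit 1))) (field (saE spE) 2))
        (seq (store (cell 6 (add spE (lit 1))) (field (sbE spE) 2))
          (seq (store (cell 7 (add spE (lit 1))) (kdE spE))
            (seq (store (cell 5 spE) (field (saE spE) 3))
              (seq (store (cell 6 spE) (field (sbE spE) 3))
                (store (lit 8) (add spE (lit 2))))))))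
      (seq (store (cell 5 spE) (field (saE spE) 2))
        (seq (store (cell 6 spE) (field (sbE spE) 2))
          (store (lit 8) (add spE (lit 1))))))
    skip

/-- Field `0` separates variable nodes from applications, so comparing fields `0` and `1` detects
all clashes in which at least one root is an application. -/
def compareRoots : Prog :=
  cond (add (neq (input (saE spE)) (input (sbE spE)))
      (neq (field (saE spE) 1) (field (sbE spE) 1)))
    next pushArgs

def equalUnforced : Prog :=
  cond (input (saE spE)) compareRoots
    (cond (add (input (sbE spE)) (neq (field (saE spE) 1) (field (sbE spE) 1))) next skip)

def processEqual : Prog :=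
  cond (neq (runE (saE spE)) (runE (sbE spE))) equalUnforced
    (cond (sub (runE (saE spE)) (lit 1))
      (cond (arr 6 (sub (runE (saE spE)) (lit 2))) skip equalUnforced)
      equalUnforced)

/-- A binding counts only if its tag is the current counter `k`. The table therefore needs no
clearing between elements of `S`, and the time per element does not depend on the number of
variables. -/
def bindVar : Prog :=
  cond (neq (vtagE (field (saE spE) 1)) kE)
    (seq (store (cell 4 (field (saE spE) 1)) kE) (store (cell 3 (field (saE spE) 1)) (sbE spE)))
    (seq (store (cell 5 spE) (vtabE (field (saE spE) 1)))
      (seq (store (cell 7 spE) (lit 1)) (store (lit 8) (add spE (lit 1)))))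

def matchVar : Prog :=
  cond (neq (runE (sbE spE)) (add (arr 4 (field (saE spE) 1)) (lit 2))) next
    (cond (arr 5 (field (saE spE) 1)) (cond (infE (sbE spE)) next bindVar) bindVar)

def processItem : Prog :=
  cond (kdE spE) processEqual (cond (input (saE spE)) compareRoots matchVar)

/-- An empty stack means that the current element of `S` matches under every solution: setting `k`
to `0` ends the loop with the answer still `0`. -/
def process : Prog :=
  cond spE (seq (store (lit 8) (sub spE (lit 1))) processItem) (store (lit 16) (lit 0))

/-- Push the root of `s`. -/
def init : Prog := seq (store (cell 5 (lit 0)) (input (lit 0))) (store (lit 8) (lit 1))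

/-- Start with the last element of `S`. -/
def start : Prog := seq (store (lit 16) (add (input (lit 1)) (lit 1))) next

/-- The decision procedure. -/
def decide : Prog :=
  -- For empty `S` the time bound is a constant, so `s` must not be traversed; the answer is `1`
  -- because solutions exist.
  cond (input (lit 1))
    (seq init (seq (loop spE visit) (seq start (loop kE process))))
    (store (lit 0) (lit 1))

theorem loopFree_visit : visit.LoopFree := by
  simp [visit, visitOne, visitTwo, push, finish, LoopFree]

theorem loopFree_process : process.LoopFree := by
  simp [process, processItem, processEqual, equalUnforced, compareRoots, matchVar, bindVar, pushArgs, next,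
    skip, LoopFree]

section Eval

variable (I : ℕ → ℕ) (s : St)

theorem apply_skip : skip.apply I s.enc = s.enc := by
  simp [skip, Prog.apply, Expr.eval]

/-- The effect of `next`. -/
def St.next : St :=
  { s with
    k := s.k - 1
    ans := 1 - (s.k - 1)
    sa := upd s.sa 0 (I (I 2 + (s.k - 1 - 1)))
    sb := upd s.sb 0 (I 0)
    kd := upd s.kd 0 0
    sp := 1 }

theorem apply_next : next.apply I s.enc = (s.next I).enc := by
  simp [next, Prog.apply, Expr.eval, kE, arr, St.next]

end Eval

end RAM

/-! ### Codes of terms and states -/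

namespace Naming

variable {F Q V : Type*} {ar : F → ℕ}

/-- Names are injective, so an address determines its term and table entries can be indexed by
addresses. -/
theorem TermAt.unique {ν : Naming F Q V} {I : ℕ → ℕ} {t t' : Term ar V} {a : ℕ}
    (h : ν.TermAt I a t) (h' : ν.TermAt I a t') : t = t' := by
  induction t generalizing t' a with
  | var x =>
    cases t' with
    | var y => rw [ν.var.injective (h.2.symm.trans h'.2)]
    | app g args' => exact absurd (h.1.symm.trans h'.1) (by omega)
  | app f args ih =>
    cases t' with
    | var y => exact absurd (h.1.symm.trans h'.1) (by omega)
    | app g args' =>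
      obtain rfl := ν.symb.injective (h.2.1.symm.trans h'.2.1)
      congr 1
      funext i
      exact ih i (h.2.2 i) (h'.2.2 i)

/-- The code of a state in the table filled by the program. -/
def code (ν : Naming F Q V) : Option Q → ℕ
  | none => 1
  | some q => ν.state q + 2

theorem code_pos (ν : Naming F Q V) (o : Option Q) : 0 < ν.code o := by
  cases o <;> simp [code]

theorem code_injective (ν : Naming F Q V) : Function.Injective ν.code := by
  intro o o' h
  cases o <;> cases o' <;> simp [code] at h ⊢
  exact h

theorem code_eq (ν : Naming F Q V) (o : Option Q) :
    ν.code o = (o.map fun q => ν.state q + 1).getD 0 + 1 := by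
  cases o <;> simp [code]

end Naming

theorem List.foldl_ofFn_one {α β : Type*} {n : ℕ} (hn : n = 1) (g : β → α → β) (b : β)
    (qs : Fin n → α) : (List.ofFn qs).foldl g b = g b (qs ⟨0, by omega⟩) := by
  subst hn
  simp

theorem List.foldl_ofFn_two {α β : Type*} {n : ℕ} (hn : n = 2) (g : β → α → β) (b : β)
    (qs : Fin n → α) :
    (List.ofFn qs).foldl g b = g (g b (qs ⟨0, by omega⟩)) (qs ⟨1, by omega⟩) := by
  subst hn
  simp [List.ofFn_succ]

/-! ### Correctness of the traversal of `s` -/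

namespace RAM

open RAM.Expr RAM.Prog

section Visit

variable (I : ℕ → ℕ) (s : St)

def St.top : ℕ := s.sa (s.sp - 1)

/-- The effect of `finish`. -/
def St.done (r i : ℕ) : St :=
  { s with
    run := upd s.run s.top r
    inf := upd s.inf s.top i
    sp := s.sp - 1 }

/-- The effect of `push`. -/
def St.push (a : ℕ) : St :=
  { s with
    sa := upd s.sa s.sp a
    sp := s.sp + 1 }

variable {I s} {a : ℕ}

theorem apply_visit_var (ha : s.top = a) (h : I a = 0) :
    visit.apply I s.enc =
      (s.done (I (I 4 + I (a + 1)) + 2) (I (I 7 + I (I 4 + I (a + 1))))).enc := by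
  subst ha
  simp only [St.top] at h
  simp [visit, finish, Prog.apply, Expr.eval, spE, topE, saE, arr, field, St.done, St.top, h]

theorem apply_visit_const (ha : s.top = a) (h : I a = 1) :
    visit.apply I s.enc = (s.done (I (I 3 + I (a + 1)) + 1) 0).enc := by
  subst ha
  simp only [St.top] at h
  simp [visit, finish, Prog.apply, Expr.eval, spE, topE, saE, arr, field, St.done, St.top, h]

theorem apply_visit_push_left (ha : s.top = a) (h : 2 ≤ I a) (h0 : s.run (I (a + 2)) = 0) :
    visit.apply I s.enc = (s.push (I (a + 2))).enc := by
  subst ha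
  simp only [St.top] at h h0
  have h1 : I (s.sa (s.sp - 1)) ≠ 0 := by omega
  have h2 : I (s.sa (s.sp - 1)) - 1 ≠ 0 := by omega
  simp [visit, push, Prog.apply, Expr.eval, spE, topE, saE, runE, field, St.push, St.top, h0, h1,
    h2]

theorem apply_visit_push_right (ha : s.top = a) (h : 3 ≤ I a) (h0 : s.run (I (a + 2)) ≠ 0)
    (h1 : s.run (I (a + 3)) = 0) :
    visit.apply I s.enc = (s.push (I (a + 3))).enc := by
  subst ha
  simp only [St.top] at h h0 h1
  have h2 : I (s.sa (s.sp - 1)) ≠ 0 := by omega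
  have h3 : I (s.sa (s.sp - 1)) - 1 ≠ 0 := by omega
  have h4 : I (s.sa (s.sp - 1)) - 2 ≠ 0 := by omega
  simp [visit, push, Prog.apply, Expr.eval, spE, topE, saE, runE, field, St.push, St.top, h0, h1,
    h2, h3, h4]

theorem apply_visit_one (ha : s.top = a) (h : I a = 2) (h0 : s.run (I (a + 2)) ≠ 0) :
    visit.apply I s.enc =
      (s.done (if s.run (I (a + 2)) - 1 = 0 then 1 else
          I (I (I 3 + I (a + 1)) + (s.run (I (a + 2)) - 2)) + 1)
        (s.inf (I (a + 2)))).enc := by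
  subst ha
  simp only [St.top] at h h0
  by_cases h1 : s.run (I (s.sa (s.sp - 1) + 2)) - 1 = 0 <;>
  simp [visit, visitOne, finish, Prog.apply, Expr.eval, spE, topE, saE, runE, infE, field, arr,
    St.done, St.top, h0, h, h1]

theorem apply_visit_two (ha : s.top = a) (h : I a = 3) (h0 : s.run (I (a + 2)) ≠ 0)
    (h1 : s.run (I (a + 3)) ≠ 0) :
    visit.apply I s.enc =
      (s.done (if s.run (I (a + 2)) - 1 = 0 ∨ s.run (I (a + 3)) - 1 = 0 then 1 else
          I (I (I (I 3 + I (a + 1)) + (s.run (I (a + 2)) - 2)) + (s.run (I (a + 3)) - 2)) + 1)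
        (s.inf (I (a + 2)) + s.inf (I (a + 3)))).enc := by
  subst ha
  simp only [St.top] at h h0 h1
  by_cases h2 : s.run (I (s.sa (s.sp - 1) + 2)) - 1 = 0 <;>
  by_cases h3 : s.run (I (s.sa (s.sp - 1) + 3)) - 1 = 0 <;>
  simp [visit, visitTwo, finish, Prog.apply, Expr.eval, spE, topE, saE, runE, infE, field, arr,
    St.done, St.top, h0, h, h1, h2, h3]

end Visit

section Table

variable {F Q V : Type*} {ar : F → ℕ} (ν : Naming F Q V) (I : ℕ → ℕ)
  (R : RestrictedConstraint ar Q V)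

/-- The nonzero entries of the tables are correct. -/
def TableGood (s : St) : Prop :=
  ∀ a (u : Term ar V), ν.TermAt I a u → s.run a ≠ 0 →
    s.run a = ν.code (R.A.runVars R.C u) ∧ (s.inf a = 0 ↔ R.FinVars u) ∧
      ∀ f args, u = .app f args → ∀ i : Fin (ar f), s.run (I (a + 2 + i)) ≠ 0

variable {ν I R}

theorem TableGood.done {s : St} (hs : TableGood ν I R s) {a r i : ℕ} {u : Term ar V}
    (ha : s.top = a) (hu : ν.TermAt I a u) (hr : r = ν.code (R.A.runVars R.C u))
    (hi : i = 0 ↔ R.FinVars u)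
    (hc : ∀ f args, u = .app f args → ∀ i : Fin (ar f), s.run (I (a + 2 + i)) ≠ 0) :
    TableGood ν I R (s.done r i) := by
  have hpos : r ≠ 0 := by
    have := ν.code_pos (R.A.runVars R.C u)
    omega
  have hmono : ∀ b, s.run b ≠ 0 → (s.done r i).run b ≠ 0 := by
    intro b hb
    simp only [St.done, upd]
    split_ifs <;> assumption
  intro b w hw hb
  by_cases hba : b = a
  · subst hba
    obtain rfl := hw.unique hu
    simp only [St.done, ha, upd_self]
    refine ⟨hr, hi, fun f args h j => ?_⟩
    have := hmono _ (hc f args h j)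
    simpa only [St.done, ha] using this
  · simp only [St.done, ha, upd_of_ne hba] at hb ⊢
    obtain ⟨h1, h2, h3⟩ := hs b w hw hb
    refine ⟨h1, h2, fun f args h j => ?_⟩
    have := hmono _ (h3 f args h j)
    simpa only [St.done, ha] using this

/-- What processing the topmost node of the stack of height `n + 1` achieves. -/
structure Visited (ν : Naming F Q V) (I : ℕ → ℕ) (R : RestrictedConstraint ar Q V) (n a : ℕ)
    (s s' : St) : Prop where
  sp : s'.sp = n
  table : TableGood ν I R s'
  run : s'.run a ≠ 0
  mono : ∀ b, s.run b ≠ 0 → s'.run b ≠ 0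
  sa : ∀ i < n, s'.sa i = s.sa i
  vtag : s'.vtag = s.vtag

theorem Visited.done {s : St} (hs : TableGood ν I R s) {n a r i : ℕ} {u : Term ar V}
    (hn : s.sp = n + 1) (ha : s.sa n = a) (hu : ν.TermAt I a u)
    (hr : r = ν.code (R.A.runVars R.C u)) (hi : i = 0 ↔ R.FinVars u)
    (hc : ∀ f args, u = .app f args → ∀ i : Fin (ar f), s.run (I (a + 2 + i)) ≠ 0) :
    Visited ν I R n a s (s.done r i) := by
  have ht : s.top = a := by simp [St.top, hn, ha]
  have hpos : r ≠ 0 := by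
    have := ν.code_pos (R.A.runVars R.C u)
    omega
  refine ⟨by simp [St.done, hn], hs.done ht hu hr hi hc, by simp [St.done, ht, hpos], ?_,
    fun _ _ => rfl, rfl⟩
  intro b hb
  simp only [St.done, upd]
  split_ifs <;> assumption

/-- Every node is finished in one round and every node except the root is pushed in one, which gives
at most `2|u| - 1` rounds. The spare round pays for pushing `u` itself from its parent. -/
def CanVisit (ν : Naming F Q V) (I : ℕ → ℕ) (R : RestrictedConstraint ar Q V) (u : Term ar V) :
    Prop :=
  ∀ a, ν.TermAt I a u → ∀ (s : St) (n : ℕ), s.sp = n + 1 → s.sa n = a → TableGood ν I R s →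
    ∃ m, m + 1 ≤ 2 * u.size ∧ ∃ s' : St, Rounds I spE visit m s.enc s'.enc ∧ Visited ν I R n a s s'

/-- A child of the topmost node is processed unless this has been done before. -/
theorem CanVisit.child {u : Term ar V} (hu : CanVisit ν I R u) {c : ℕ} (hc : ν.TermAt I c u)
    {s : St} {n : ℕ} (hn : s.sp = n + 1) (hs : TableGood ν I R s)
    (h : s.run c = 0 → visit.apply I s.enc = (s.push c).enc) :
    ∃ m ≤ 2 * u.size, ∃ s' : St, Rounds I spE visit m s.enc s'.enc ∧
      Visited ν I R (n + 1) c s s' := by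
  by_cases h0 : s.run c = 0
  · obtain ⟨m, hm, s', h1, h2⟩ := hu c hc (s.push c) (n + 1) (by simp [St.push, hn])
      (by simp [St.push, hn]) hs
    refine ⟨1 + m, by omega, s', ?_, ⟨h2.sp, h2.table, h2.run, h2.mono, fun i hi => ?_, h2.vtag⟩⟩
    · refine Rounds.trans (.single ?_) (h h0 ▸ h1)
      simp [spE, Expr.eval, hn]
    · rw [h2.sa i hi]
      exact upd_of_ne (by omega) _ _
  · exact ⟨0, by omega, s, .zero _, ⟨hn, hs, h0, fun _ h => h, fun _ _ => rfl, rfl⟩⟩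

theorem Visited.trans {n a c : ℕ} {s s' s'' : St} (h : Visited ν I R (n + 1) c s s')
    (h' : Visited ν I R n a s' s'') : Visited ν I R n a s s'' :=
  ⟨h'.sp, h'.table, h'.run, fun b hb => h'.mono b (h.mono b hb),
    fun i hi => (h'.sa i hi).trans (h.sa i (by omega)), h'.vtag.trans h.vtag⟩

theorem rounds_visit {s s' : St} (hs : s.sp ≠ 0) (h : visit.apply I s.enc = s'.enc) :
    Rounds I spE visit 1 s.enc s'.enc :=
  h ▸ .single (by simpa [spE, Expr.eval] using hs)

variable {S : Finset (Term ar V)} {t : Term ar V}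

theorem canVisit (har : ∀ f, ar f ≤ 2) (hI : ν.Represents I R S t) (u : Term ar V) :
    CanVisit ν I R u := by
  induction u with
  | var x =>
    intro a ha s n hn hsa hs
    have ht : s.top = a := by simp [St.top, hn, hsa]
    refine ⟨1, by simp [Term.size], _, rounds_visit (by omega) (apply_visit_var ht ha.1),
      .done hs hn hsa ha ?_ ?_ (by simp)⟩
    · rw [ha.2, hI.varState]
      rfl
    · rw [ha.2, hI.varState, hI.infinite]
      simp [RestrictedConstraint.FinVars, Term.AllVars]
  | app f args ih =>
    intro a ha s n hn hsa hs
    have ht : s.top = a := by simp [St.top, hn, hsa]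
    have htag := ha.1
    have hf := har f
    rcases (show ar f = 0 ∨ ar f = 1 ∨ ar f = 2 by omega) with h0 | h1 | h2
    · refine ⟨1, by simp only [Term.size]; omega, _, rounds_visit (by omega)
        (apply_visit_const ht (by omega)), .done hs hn hsa ha ?_ ?_ ?_⟩
      · have hqs : ∀ i, R.A.runVars R.C (args i) = some ((fun i => absurd i.2 (by omega)) i) :=
          fun i => absurd i.2 (by omega)
        have hδ := hI.trans f fun i => absurd i.2 (by omega)
        rw [DTA.runVars_app_eq_of_forall hqs, Naming.code_eq, ← hδ, ha.2.1,
          List.ofFn_congr h0]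
        simp
      · simp only [true_iff]
        exact fun i => absurd i.2 (by omega)
      · rintro g args' h i
        cases h
        exact absurd i.2 (by omega)
    · let i0 : Fin (ar f) := ⟨0, by omega⟩
      have hi : ∀ i : Fin (ar f), i = i0 := fun i => Fin.ext (by simp [i0]; omega)
      have hc : ν.TermAt I (I (a + 2)) (args i0) := ha.2.2 i0
      obtain ⟨m, hm, s1, hr1, hv1⟩ := (ih i0).child hc hn hs
        (apply_visit_push_left ht (by omega))
      have hsa1 : s1.sa n = a := (hv1.sa n (by omega)).trans hsa
      have ht1 : s1.top = a := by simp [St.top, hv1.sp, hsa1]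
      refine ⟨m + 1, ?_, _, hr1.trans (rounds_visit (by rw [hv1.sp]; omega)
        (apply_visit_one ht1 (by omega) hv1.run)), hv1.trans
        (.done hv1.table hv1.sp hsa1 ha ?_ ?_ ?_)⟩
      · have := Term.size_lt_size_app f args i0
        omega
      · obtain ⟨hcode, -, -⟩ := hv1.table _ _ hc hv1.run
        rw [hcode]
        cases hq : R.A.runVars R.C (args i0) with
        | none => simp [Naming.code, DTA.runVars_app_eq_none hq]
        | some q =>
          have hqs : ∀ i, R.A.runVars R.C (args i) = some ((fun _ => q) i) := fun i => by
            rw [hi i, hq]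
          have hδ := hI.trans f fun _ => q
          rw [List.foldl_ofFn_one h1] at hδ
          rw [DTA.runVars_app_eq_of_forall hqs, Naming.code_eq, Naming.code_eq, ← hδ, ha.2.1]
          simp
      · obtain ⟨-, hfin, -⟩ := hv1.table _ _ hc hv1.run
        rw [hfin]
        exact ⟨fun h i => hi i ▸ h, fun h => h i0⟩
      · rintro g args' h i
        cases h
        rw [hi i]
        exact hv1.run
    · let i0 : Fin (ar f) := ⟨0, by omega⟩
      let i1 : Fin (ar f) := ⟨1, by omega⟩
      have hi : ∀ i : Fin (ar f), i = i0 ∨ i = i1 := fun i => by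
        simp only [i0, i1, Fin.ext_iff]
        omega
      have hc0 : ν.TermAt I (I (a + 2)) (args i0) := ha.2.2 i0
      have hc1 : ν.TermAt I (I (a + 3)) (args i1) := ha.2.2 i1
      obtain ⟨m, hm, s1, hr1, hv1⟩ := (ih i0).child hc0 hn hs
        (apply_visit_push_left ht (by omega))
      have hsa1 : s1.sa n = a := (hv1.sa n (by omega)).trans hsa
      have ht1 : s1.top = a := by simp [St.top, hv1.sp, hsa1]
      obtain ⟨m', hm', s2, hr2, hv2⟩ := (ih i1).child hc1 hv1.sp hv1.table
        (apply_visit_push_right ht1 (by omega) hv1.run)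
      have hsa2 : s2.sa n = a := (hv2.sa n (by omega)).trans hsa1
      have ht2 : s2.top = a := by simp [St.top, hv2.sp, hsa2]
      have hrun0 := hv2.mono _ hv1.run
      obtain ⟨hcode0, hfin0, -⟩ := hv2.table _ _ hc0 hrun0
      obtain ⟨hcode1, hfin1, -⟩ := hv2.table _ _ hc1 hv2.run
      refine ⟨m + m' + 1, ?_, _, (hr1.trans hr2).trans (rounds_visit (by rw [hv2.sp]; omega)
        (apply_visit_two ht2 (by omega) hrun0 hv2.run)), hv1.trans (hv2.trans
        (.done hv2.table hv2.sp hsa2 ha ?_ ?_ ?_))⟩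
      · have : (args i0).size + (args i1).size ≤ ∑ i, (args i).size := by
          rw [← Finset.sum_pair (f := fun i => (args i).size) (show i0 ≠ i1 by simp [i0, i1])]
          exact Finset.sum_le_sum_of_subset (Finset.subset_univ _)
        simp only [Term.size]
        omega
      · rw [hcode0, hcode1]
        cases hq0 : R.A.runVars R.C (args i0) with
        | none => simp [Naming.code, DTA.runVars_app_eq_none hq0]
        | some q0 =>
          cases hq1 : R.A.runVars R.C (args i1) with
          | none => simp [Naming.code, DTA.runVars_app_eq_none hq1]
          | some q1 =>
            have hqs : ∀ i, R.A.runVars R.C (args i) =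
                some ((fun i : Fin (ar f) => if (i : ℕ) = 0 then q0 else q1) i) := fun i => by
              rcases hi i with rfl | rfl
              · simp [hq0, i0]
              · simp [hq1, i1]
            have hδ := hI.trans f fun i : Fin (ar f) => if (i : ℕ) = 0 then q0 else q1
            rw [List.foldl_ofFn_two h2] at hδ
            rw [DTA.runVars_app_eq_of_forall hqs, ν.code_eq (R.A.δ f _), ← hδ, ha.2.1]
            simp [Naming.code]
      · rw [Nat.add_eq_zero_iff, hfin0, hfin1]
        refine ⟨fun h i => ?_, fun h => ⟨h i0, h i1⟩⟩
        rcases hi i with rfl | rfl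
        exacts [h.1, h.2]
      · rintro g args' h i
        cases h
        rcases hi i with rfl | rfl
        exacts [hrun0, hv2.run]

end Table

end RAM

theorem List.ofFn_eq_nil_of_eq {α : Type*} {n : ℕ} (hn : n = 0) (g : Fin n → α) :
    List.ofFn g = [] := by
  subst hn
  simp

theorem List.ofFn_eq_singleton {α : Type*} {n : ℕ} (hn : n = 1) (g : Fin n → α) :
    List.ofFn g = [g ⟨0, by omega⟩] := by
  subst hn
  simp

theorem List.ofFn_eq_pair {α : Type*} {n : ℕ} (hn : n = 2) (g : Fin n → α) :
    List.ofFn g = [g ⟨0, by omega⟩, g ⟨1, by omega⟩] := by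
  subst hn
  simp [List.ofFn_succ]

/-! ### Simulation of the worklist -/

namespace RAM

open RAM.Expr RAM.Prog RestrictedConstraint

section Programs

variable {I : ℕ → ℕ} {s : St} {a b x : ℕ}

theorem apply_process_nil (h : s.sp = 0) : process.apply I s.enc = St.enc { s with k := 0 } := by
  simp [process, Prog.apply, Expr.eval, spE, h]

theorem apply_process (h : s.sp ≠ 0) :
    process.apply I s.enc = processItem.apply I (St.enc { s with sp := s.sp - 1 }) := by
  simp [process, Prog.apply, Expr.eval, spE, h]

theorem apply_pushArgs_zero (ha : s.sa s.sp = a) (h : I a = 1) :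
    pushArgs.apply I s.enc = s.enc := by
  simp [pushArgs, Prog.apply, Expr.eval, spE, saE, ha, h, apply_skip]

theorem apply_pushArgs_one (ha : s.sa s.sp = a) (hb : s.sb s.sp = b) (h : I a = 2) :
    pushArgs.apply I s.enc = St.enc { s with
      sa := upd s.sa s.sp (I (a + 2)), sb := upd s.sb s.sp (I (b + 2)), sp := s.sp + 1 } := by
  simp [pushArgs, Prog.apply, Expr.eval, spE, saE, sbE, field, ha, hb, h]

theorem apply_pushArgs_two (ha : s.sa s.sp = a) (hb : s.sb s.sp = b) (h : I a = 3) :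
    pushArgs.apply I s.enc = St.enc { s with
      sa := upd (upd s.sa (s.sp + 1) (I (a + 2))) s.sp (I (a + 3))
      sb := upd (upd s.sb (s.sp + 1) (I (b + 2))) s.sp (I (b + 3))
      kd := upd s.kd (s.sp + 1) (s.kd s.sp)
      sp := s.sp + 2 } := by
  simp [pushArgs, Prog.apply, Expr.eval, spE, saE, sbE, kdE, field, ha, hb, h]

theorem apply_compareRoots (ha : s.sa s.sp = a) (hb : s.sb s.sp = b) (h : I a = I b)
    (h' : I (a + 1) = I (b + 1)) : compareRoots.apply I s.enc = pushArgs.apply I s.enc := by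
  simp [compareRoots, Prog.apply, Expr.eval, neq, spE, saE, sbE, field, ha, hb, h, h']

theorem apply_compareRoots_next (ha : s.sa s.sp = a) (hb : s.sb s.sp = b)
    (h : I a ≠ I b ∨ I (a + 1) ≠ I (b + 1)) :
    compareRoots.apply I s.enc = (s.next I).enc := by
  have : ¬ (((I a - I b = 0) ∧ (I b - I a = 0)) ∧
    ((I (a + 1) - I (b + 1) = 0) ∧ (I (b + 1) - I (a + 1) = 0))) := by omega
  simp [compareRoots, Prog.apply, Expr.eval, neq, spE, saE, sbE, field, ha, hb, apply_next, this,
    -not_and]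

theorem apply_equalUnforced (ha : s.sa s.sp = a) (h : I a ≠ 0) :
    equalUnforced.apply I s.enc = compareRoots.apply I s.enc := by
  simp [equalUnforced, Prog.apply, Expr.eval, spE, saE, ha, h]

theorem apply_equalUnforced_skip (ha : s.sa s.sp = a) (hb : s.sb s.sp = b) (h : I a = 0)
    (h' : I b = 0) (h1 : I (a + 1) = I (b + 1)) : equalUnforced.apply I s.enc = s.enc := by
  simp [equalUnforced, Prog.apply, Expr.eval, neq, field, spE, saE, sbE, ha, hb, h, h', h1,
    apply_skip]

theorem apply_equalUnforced_next (ha : s.sa s.sp = a) (hb : s.sb s.sp = b) (h : I a = 0)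
    (h' : I b ≠ 0 ∨ I (a + 1) ≠ I (b + 1)) :
    equalUnforced.apply I s.enc = (s.next I).enc := by
  have : ¬ (I b = 0 ∧ ((I (a + 1) - I (b + 1) = 0) ∧ (I (b + 1) - I (a + 1) = 0))) := by omega
  simp [equalUnforced, Prog.apply, Expr.eval, neq, spE, saE, sbE, field, ha, hb, h, apply_next,
    this, -not_and]

theorem apply_processEqual (ha : s.sa s.sp = a) (hb : s.sb s.sp = b) :
    processEqual.apply I s.enc =
      if s.run a = s.run b ∧ s.run a - 1 ≠ 0 ∧ I (I 6 + (s.run a - 2)) ≠ 0 then s.enc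
      else equalUnforced.apply I s.enc := by
  have h0 : (s.run a - s.run b = 0 ∧ s.run b - s.run a = 0) ↔ s.run a = s.run b := by omega
  by_cases h1 : s.run a = s.run b <;> by_cases h2 : s.run a - 1 = 0 <;>
    by_cases h3 : I (I 6 + (s.run a - 2)) = 0 <;>
  simp [processEqual, Prog.apply, Expr.eval, neq, spE, saE, sbE, runE, arr, ha, hb, apply_skip, h0,
    h1, h2, h3] <;> simp_all

theorem apply_matchVar_next (ha : s.sa s.sp = a) (hb : s.sb s.sp = b)
    (h : s.run b ≠ I (I 4 + I (a + 1)) + 2 ∨ I (I 5 + I (a + 1)) ≠ 0 ∧ s.inf b ≠ 0) :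
    matchVar.apply I s.enc = (s.next I).enc := by
  have h0 : (s.run b - (I (I 4 + I (a + 1)) + 2) = 0 ∧ (I (I 4 + I (a + 1)) + 2) - s.run b = 0) ↔
    s.run b = I (I 4 + I (a + 1)) + 2 := by omega
  by_cases h1 : s.run b = I (I 4 + I (a + 1)) + 2
  · obtain ⟨h2, h3⟩ := h.resolve_left (not_not.2 h1)
    simp [matchVar, Prog.apply, Expr.eval, neq, spE, saE, sbE, runE, infE, arr, field, ha, hb, h1,
      h2, h3, apply_next]
  · simp [matchVar, Prog.apply, Expr.eval, neq, spE, saE, sbE, runE, arr, field, ha, hb, h0, h1,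
      apply_next]

theorem apply_matchVar (ha : s.sa s.sp = a) (hb : s.sb s.sp = b)
    (h1 : s.run b = I (I 4 + I (a + 1)) + 2) (h2 : I (I 5 + I (a + 1)) ≠ 0 → s.inf b = 0) :
    matchVar.apply I s.enc = bindVar.apply I s.enc := by
  by_cases h3 : I (I 5 + I (a + 1)) = 0
  · simp [matchVar, Prog.apply, Expr.eval, neq, spE, saE, sbE, runE, arr, field, ha, hb, h1, h3]
  · simp [matchVar, Prog.apply, Expr.eval, neq, spE, saE, sbE, runE, infE, arr, field, ha, hb, h1,
      h3, h2 h3]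

theorem apply_bindVar_bind (ha : s.sa s.sp = a) (hb : s.sb s.sp = b)
    (h : s.vtag (I (a + 1)) ≠ s.k) :
    bindVar.apply I s.enc = St.enc { s with
      vtag := upd s.vtag (I (a + 1)) s.k, vtab := upd s.vtab (I (a + 1)) b } := by
  have h0 : ¬ (s.vtag (I (a + 1)) - s.k = 0 ∧ s.k - s.vtag (I (a + 1)) = 0) := by omega
  simp [bindVar, Prog.apply, Expr.eval, neq, spE, kE, saE, sbE, vtagE, field, ha, hb, h0,
    -not_and]

theorem apply_bindVar_bound (ha : s.sa s.sp = a) (h : s.vtag (I (a + 1)) = s.k) :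
    bindVar.apply I s.enc = St.enc { s with
      sa := upd s.sa s.sp (s.vtab (I (a + 1))), kd := upd s.kd s.sp 1, sp := s.sp + 1 } := by
  simp [bindVar, Prog.apply, Expr.eval, neq, spE, kE, saE, vtagE, vtabE, field, ha, h]

end Programs

section Simulation

variable {F Q V : Type*} {ar : F → ℕ} (ν : Naming F Q V) (I : ℕ → ℕ)
  (R : RestrictedConstraint ar Q V)

/-- Entry `n` of the stack is a pair of nodes representing `t` and `u`, with mark `d`. -/
def PairAt (s : St) (n d : ℕ) (t u : Term ar V) : Prop :=
  s.kd n = d ∧ ν.TermAt I (s.sa n) t ∧ ν.TermAt I (s.sb n) u ∧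
    (d ≠ 0 → s.run (s.sa n) ≠ 0) ∧ s.run (s.sb n) ≠ 0

/-- In a matching item the left node comes from an element of `S`, which is not traversed, so mark
`0` demands a table entry only for the right node. In an equation both nodes come from `s`. -/
def ItemAt (s : St) (n : ℕ) : Item ar V → Prop
  | .matching t u => PairAt ν I s n 0 t u
  | .equal u v => PairAt ν I s n 1 u v

/-- The worklist is represented by the stack; its head is on top. -/
def StackAt (s : St) : List (Item ar V) → Prop
  | [] => True
  | i :: L => ItemAt ν I s L.length i ∧ StackAt s L

/-- The bindings are represented by the entries of the variable table with tag `k`. -/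
def EnvAt (s : St) (e : Env ar V) : Prop :=
  ∀ x, (e x = none → s.vtag (ν.var x) ≠ s.k) ∧ ∀ u, e x = some u →
    s.vtag (ν.var x) = s.k ∧ ν.TermAt I (s.vtab (ν.var x)) u ∧ s.run (s.vtab (ν.var x)) ≠ 0

/-- No tag has been used for elements of `S` that are still to be treated. -/
def TagsFresh (s : St) (k : ℕ) : Prop := ∀ n, s.vtag n = 0 ∨ k ≤ s.vtag n

structure Represented (k : ℕ) (e : Env ar V) (L : List (Item ar V)) (s : St) : Prop where
  ans : s.ans = 0
  k_eq : s.k = k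
  sp : s.sp = L.length
  table : TableGood ν I R s
  root : s.run (I 0) ≠ 0
  tags : TagsFresh s k
  env : EnvAt ν I s e
  stack : StackAt ν I s L

variable {ν I R}

theorem PairAt.congr {s s' : St} {n d : ℕ} {t u : Term ar V} (h : PairAt ν I s n d t u)
    (hrun : s'.run = s.run) (hkd : s'.kd n = s.kd n) (hsa : s'.sa n = s.sa n)
    (hsb : s'.sb n = s.sb n) : PairAt ν I s' n d t u := by
  unfold PairAt
  rwa [hrun, hkd, hsa, hsb]

theorem StackAt.congr {s s' : St} {L : List (Item ar V)} (h : StackAt ν I s L)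
    (hrun : s'.run = s.run)
    (h' : ∀ n < L.length, s'.kd n = s.kd n ∧ s'.sa n = s.sa n ∧ s'.sb n = s.sb n) :
    StackAt ν I s' L := by
  induction L with
  | nil => trivial
  | cons i L ih =>
    refine ⟨?_, ih h.2 fun n hn => h' n (by simp only [List.length_cons]; omega)⟩
    obtain ⟨h1, h2, h3⟩ := h' L.length (by simp)
    have h4 := h.1
    cases i with
    | matching t u => exact PairAt.congr h4 hrun h1 h2 h3
    | equal u v => exact PairAt.congr h4 hrun h1 h2 h3

/-- This is the purpose of the last clause of `TableGood`: items pushed for children again refer to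
evaluated nodes. -/
theorem TableGood.arg {s : St} (hs : TableGood ν I R s) {a : ℕ} {f : F}
    {args : Fin (ar f) → Term ar V} (ha : ν.TermAt I a (.app f args)) (h : s.run a ≠ 0)
    (i : Fin (ar f)) : s.run (I (a + 2 + i)) ≠ 0 :=
  (hs a _ ha h).2.2 f args rfl i

/-- The items for the children are pushed. -/
theorem represented_pushArgs (har : ∀ f, ar f ≤ 2) {k : ℕ} {e : Env ar V} {L : List (Item ar V)}
    {s : St} (hs : Represented ν I R k e L s) {d : ℕ} {mk : Term ar V → Term ar V → Item ar V}
    (hmk : ∀ s n t u, ItemAt ν I s n (mk t u) = PairAt ν I s n d t u) {f : F}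
    {args args' : Fin (ar f) → Term ar V}
    (hp : PairAt ν I s s.sp d (.app f args) (.app f args')) :
    ∃ s' : St, pushArgs.apply I s.enc = s'.enc ∧
      Represented ν I R k e (List.ofFn (fun i => mk (args i) (args' i)) ++ L) s' := by
  obtain ⟨hkd, ha, hb, hra, hrb⟩ := hp
  have htag := ha.1
  have hf := har f
  have hra' : d ≠ 0 → ∀ i : Fin (ar f), s.run (I (s.sa s.sp + 2 + i)) ≠ 0 :=
    fun hd => hs.table.arg ha (hra hd)
  have hrb' := hs.table.arg hb hrb
  have hsp := hs.sp
  rcases (show ar f = 0 ∨ ar f = 1 ∨ ar f = 2 by omega) with h0 | h1 | h2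
  · rw [List.ofFn_eq_nil_of_eq h0]
    exact ⟨s, apply_pushArgs_zero rfl (by omega), hs⟩
  · rw [List.ofFn_eq_singleton h1, List.cons_append, List.nil_append]
    refine ⟨_, apply_pushArgs_one rfl rfl (by omega), hs.ans, hs.k_eq, by simp [hsp], hs.table,
      hs.root, hs.tags, hs.env, ?_, hs.stack.congr rfl fun n hn => ?_⟩
    · rw [hmk, ← hsp]
      simp only [PairAt, upd_self]
      exact ⟨hkd, ha.2.2 ⟨0, by omega⟩, hb.2.2 ⟨0, by omega⟩, fun hd => hra' hd ⟨0, by omega⟩,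
        hrb' ⟨0, by omega⟩⟩
    · have : n ≠ s.sp := by omega
      simp [this]
  · rw [List.ofFn_eq_pair h2, List.cons_append, List.cons_append, List.nil_append]
    refine ⟨_, apply_pushArgs_two rfl rfl (by omega), hs.ans, hs.k_eq, by simp [hsp], hs.table,
      hs.root, hs.tags, hs.env, ?_, ?_, hs.stack.congr rfl fun n hn => ?_⟩
    · rw [hmk, List.length_cons, ← hsp]
      simp only [PairAt, upd_self, ne_eq, Nat.add_eq_left, one_ne_zero, not_false_eq_true,
        upd_of_ne]
      exact ⟨hkd, ha.2.2 ⟨0, by omega⟩, hb.2.2 ⟨0, by omega⟩, fun hd => hra' hd ⟨0, by omega⟩,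
        hrb' ⟨0, by omega⟩⟩
    · rw [hmk, ← hsp]
      simp only [PairAt, upd_self, ne_eq, Nat.left_eq_add, one_ne_zero, not_false_eq_true,
        upd_of_ne]
      exact ⟨hkd, ha.2.2 ⟨1, by omega⟩, hb.2.2 ⟨1, by omega⟩, fun hd => hra' hd ⟨1, by omega⟩,
        hrb' ⟨1, by omega⟩⟩
    · have h3 : n ≠ s.sp := by omega
      have h4 : n ≠ s.sp + 1 := by omega
      simp [h3, h4]

variable {S : Finset (Term ar V)} {t : Term ar V}

/-- Codes are injective, so equal entries mean equal states; the middle test discards the case that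
both are undefined. -/
theorem forced_iff (hI : ν.Represents I R S t) {s : St} (hs : TableGood ν I R s) {a b : ℕ}
    {u v : Term ar V} (ha : ν.TermAt I a u) (hb : ν.TermAt I b v) (hra : s.run a ≠ 0)
    (hrb : s.run b ≠ 0) :
    (s.run a = s.run b ∧ s.run a - 1 ≠ 0 ∧ I (I 6 + (s.run a - 2)) ≠ 0) ↔ R.Forced u v := by
  rw [(hs a u ha hra).1, (hs b v hb hrb).1, ν.code_injective.eq_iff]
  constructor
  · rintro ⟨h1, h2, h3⟩
    cases hq : R.A.runVars R.C u with
    | none => simp [hq, Naming.code] at h2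
    | some q =>
      refine ⟨q, hq, h1 ▸ hq, ?_⟩
      simpa [hq, Naming.code, hI.singleton] using h3
  · rintro ⟨q, hu, hv, h⟩
    simp [hu, hv, Naming.code, hI.singleton, h]

theorem apply_processItem_equal {s : St} (h : s.kd s.sp = 1) :
    processItem.apply I s.enc = processEqual.apply I s.enc := by
  simp [processItem, Prog.apply, Expr.eval, kdE, spE, h]

theorem apply_processItem_app {s : St} (h : s.kd s.sp = 0) (h' : I (s.sa s.sp) ≠ 0) :
    processItem.apply I s.enc = compareRoots.apply I s.enc := by
  simp [processItem, Prog.apply, Expr.eval, kdE, saE, spE, h, h']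

theorem apply_processItem_var {s : St} (h : s.kd s.sp = 0) (h' : I (s.sa s.sp) = 0) :
    processItem.apply I s.enc = matchVar.apply I s.enc := by
  simp [processItem, Prog.apply, Expr.eval, kdE, saE, spE, h, h']

theorem run_eq_iff (hI : ν.Represents I R S t) {s : St} (hs : TableGood ν I R s) {a b : ℕ} {x : V}
    {u : Term ar V} (ha : ν.TermAt I a (.var x : Term ar V)) (hb : ν.TermAt I b u)
    (hrb : s.run b ≠ 0) :
    s.run b = I (I 4 + I (a + 1)) + 2 ↔ R.A.runVars R.C u = some (R.C x) := by
  rw [(hs b u hb hrb).1, ha.2, hI.varState, ← ν.code_injective.eq_iff]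
  rfl

theorem inf_eq_zero_iff {s : St} (hs : TableGood ν I R s) {b : ℕ} {u : Term ar V}
    (hb : ν.TermAt I b u) (hrb : s.run b ≠ 0) : s.inf b = 0 ↔ R.FinVars u :=
  (hs b u hb hrb).2.1

theorem restricted_iff (hI : ν.Represents I R S t) {a : ℕ} {x : V}
    (ha : ν.TermAt I a (.var x : Term ar V)) : I (I 5 + I (a + 1)) ≠ 0 ↔ x ∈ R.W := by
  rw [ha.2, hI.varRestricted]
  simp

open Classical in
/-- A step of the worklist is simulated. -/
theorem represented_step (har : ∀ f, ar f ≤ 2) (hI : ν.Represents I R S t) {k : ℕ}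
    {e e' : Env ar V} {L L' : List (Item ar V)} {i : Item ar V} {s : St}
    (hs : Represented ν I R k e L s) (hi : ItemAt ν I s s.sp i) (h : R.Step e i e' L') :
    ∃ s' : St, processItem.apply I s.enc = s'.enc ∧ Represented ν I R k e' (L' ++ L) s' := by
  cases h with
  | forced u v h =>
    obtain ⟨hkd, ha, hb, hra, hrb⟩ := hi
    rw [apply_processItem_equal hkd, apply_processEqual rfl rfl,
      if_pos ((forced_iff hI hs.table ha hb (hra one_ne_zero) hrb).2 h)]
    exact ⟨s, rfl, hs⟩
  | eqVar x =>
    obtain ⟨hkd, ha, hb, hra, hrb⟩ := hi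
    rw [apply_processItem_equal hkd, apply_processEqual rfl rfl,
      apply_equalUnforced_skip rfl rfl ha.1 hb.1 (ha.2.trans hb.2.symm), ite_self]
    exact ⟨s, rfl, hs⟩
  | eqApp f args args' h =>
    have hp : PairAt ν I s s.sp 1 (.app f args) (.app f args') := hi
    obtain ⟨hkd, ha, hb, hra, hrb⟩ := hi
    rw [apply_processItem_equal hkd, apply_processEqual rfl rfl,
      if_neg (fun h' => h ((forced_iff hI hs.table ha hb (hra one_ne_zero) hrb).1 h')),
      apply_equalUnforced rfl (by rw [ha.1]; omega),
      apply_compareRoots rfl rfl (ha.1.trans hb.1.symm) (ha.2.1.trans hb.2.1.symm)]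
    exact represented_pushArgs har hs (mk := .equal) (fun _ _ _ _ => rfl) hp
  | matchApp f args args' =>
    have hp : PairAt ν I s s.sp 0 (.app f args) (.app f args') := hi
    obtain ⟨hkd, ha, hb, hra, hrb⟩ := hi
    rw [apply_processItem_app hkd (by rw [ha.1]; omega),
      apply_compareRoots rfl rfl (ha.1.trans hb.1.symm) (ha.2.1.trans hb.2.1.symm)]
    exact represented_pushArgs har hs (mk := .matching) (fun _ _ _ _ => rfl) hp
  | bind x u hr hW hx =>
    obtain ⟨hkd, ha, hb, -, hrb⟩ := hi
    have hax : I (s.sa s.sp + 1) = ν.var x := ha.2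
    rw [apply_processItem_var hkd ha.1, apply_matchVar rfl rfl
      ((run_eq_iff hI hs.table ha hb hrb).2 hr)
      (fun h => (inf_eq_zero_iff hs.table hb hrb).2 (hW ((restricted_iff hI ha).1 h))),
      apply_bindVar_bind rfl rfl (by rw [hax]; exact (hs.env x).1 hx)]
    refine ⟨_, rfl, hs.ans, hs.k_eq, hs.sp, hs.table, hs.root, fun n => ?_, fun y => ?_, ?_⟩
    · simp only [upd]
      split_ifs
      · right
        rw [hs.k_eq]
      · exact hs.tags n
    · rw [hax]
      by_cases hy : y = x
      · subst hy
        simp only [Function.update_self, upd_self, reduceCtorEq, false_imp_iff, true_and,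
          Option.some.injEq]
        rintro _ rfl
        exact ⟨hb, hrb⟩
      · have : ν.var y ≠ ν.var x := fun h => hy (ν.var.injective h)
        simp only [Function.update_of_ne hy, upd_of_ne this]
        exact hs.env y
    · exact hs.stack.congr rfl fun n hn => ⟨rfl, rfl, rfl⟩
  | bound x u u' hr hW hx =>
    obtain ⟨hkd, ha, hb, -, hrb⟩ := hi
    have hax : I (s.sa s.sp + 1) = ν.var x := ha.2
    obtain ⟨h1, h2, h3⟩ := (hs.env x).2 u' hx
    rw [apply_processItem_var hkd ha.1, apply_matchVar rfl rfl
      ((run_eq_iff hI hs.table ha hb hrb).2 hr)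
      (fun h => (inf_eq_zero_iff hs.table hb hrb).2 (hW ((restricted_iff hI ha).1 h))),
      apply_bindVar_bound rfl (by rw [hax]; exact h1)]
    have hsp := hs.sp
    rw [List.cons_append, List.nil_append]
    refine ⟨_, rfl, hs.ans, hs.k_eq, by simp [hsp], hs.table, hs.root, hs.tags, hs.env, ?_,
      hs.stack.congr rfl fun n hn => ?_⟩
    · rw [← hsp]
      simp only [ItemAt, PairAt, upd_self, hax]
      exact ⟨trivial, h2, hb, fun _ => h3, hrb⟩
    · have : n ≠ s.sp := by omega
      simp [this]

theorem apply_processItem_clash (hI : ν.Represents I R S t) {i : Item ar V} {s : St}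
    (hs : TableGood ν I R s) (hi : ItemAt ν I s s.sp i) (h : R.Clash i) :
    processItem.apply I s.enc = (s.next I).enc := by
  cases h with
  | eqVarLeft x v h hv =>
    obtain ⟨hkd, ha, hb, hra, hrb⟩ := hi
    rw [apply_processItem_equal hkd, apply_processEqual rfl rfl,
      if_neg (fun h' => h ((forced_iff hI hs ha hb (hra one_ne_zero) hrb).1 h')),
      apply_equalUnforced_next rfl rfl ha.1]
    cases v with
    | var y =>
      right
      rw [ha.2, hb.2]
      exact fun h' => hv (by rw [ν.var.injective h'])
    | app g args => exact Or.inl (by rw [hb.1]; omega)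
  | eqVarRight x f args h =>
    obtain ⟨hkd, ha, hb, hra, hrb⟩ := hi
    rw [apply_processItem_equal hkd, apply_processEqual rfl rfl,
      if_neg (fun h' => h ((forced_iff hI hs ha hb (hra one_ne_zero) hrb).1 h')),
      apply_equalUnforced rfl (by rw [ha.1]; omega), apply_compareRoots_next rfl rfl]
    left
    rw [ha.1, hb.1]
    omega
  | eqApp f g args args' h hfg =>
    obtain ⟨hkd, ha, hb, hra, hrb⟩ := hi
    rw [apply_processItem_equal hkd, apply_processEqual rfl rfl,
      if_neg (fun h' => h ((forced_iff hI hs ha hb (hra one_ne_zero) hrb).1 h')),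
      apply_equalUnforced rfl (by rw [ha.1]; omega), apply_compareRoots_next rfl rfl]
    right
    rw [ha.2.1, hb.2.1]
    exact fun h' => hfg (ν.symb.injective h')
  | matchApp f g args args' hfg =>
    obtain ⟨hkd, ha, hb, hra, hrb⟩ := hi
    rw [apply_processItem_app hkd (by rw [ha.1]; omega), apply_compareRoots_next rfl rfl]
    right
    rw [ha.2.1, hb.2.1]
    exact fun h' => hfg (ν.symb.injective h')
  | matchState x u h =>
    obtain ⟨hkd, ha, hb, -, hrb⟩ := hi
    rw [apply_processItem_var hkd ha.1, apply_matchVar_next rfl rfl]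
    exact Or.inl fun h' => h ((run_eq_iff hI hs ha hb hrb).1 h')
  | matchHeight x u hx h =>
    obtain ⟨hkd, ha, hb, -, hrb⟩ := hi
    rw [apply_processItem_var hkd ha.1, apply_matchVar_next rfl rfl]
    exact Or.inr ⟨(restricted_iff hI ha).2 hx, fun h' => h ((inf_eq_zero_iff hs hb hrb).1 h')⟩

theorem rounds_process {s s' : St} (hs : s.k ≠ 0) (h : process.apply I s.enc = s'.enc) :
    Rounds I kE process 1 s.enc s'.enc :=
  h ▸ .single (by simpa [kE, Expr.eval] using hs)

/-- The worklist is processed until an item is violated or no item is left. -/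
theorem rounds_worklist [Finite Q] (har : ∀ f, ar f ≤ 2) (hI : ν.Represents I R S t) {n : ℕ}
    (hA : R.A.IsOneOr (n + 2)) (hsol : ∃ φ, R.IsSolution φ) {k : ℕ} (hk : k ≠ 0) {e : Env ar V}
    {L : List (Item ar V)} {s : St} (hs : Represented ν I R k e L s) (he : R.EnvGood e)
    (hL : ∀ i ∈ L, i.Good R) :
    ∃ m ≤ (L.map Item.weight).sum + 1, ∃ s' : St,
      (R.Refutable (R.Solves e L) ∧ Rounds I kE process m s.enc (s'.next I).enc ∧ s'.k = k ∧
        TableGood ν I R s' ∧ s'.run (I 0) ≠ 0 ∧ TagsFresh s' k) ∨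
      ((∀ φ, R.IsSolution φ → R.Solves e L φ) ∧ Rounds I kE process m s.enc s'.enc ∧ s'.k = 0 ∧
        s'.ans = 0) := by
  induction hN : (L.map Item.weight).sum using Nat.strong_induction_on generalizing e L s with
  | _ N ih =>
  have hsk : s.k ≠ 0 := hs.k_eq ▸ hk
  cases L with
  | nil =>
    -- The one round beyond the total weight, in which the empty stack is noticed.
    exact ⟨1, by omega, _, Or.inr ⟨fun φ hφ => he.solves_nil hφ,
      rounds_process hsk (apply_process_nil hs.sp), rfl, hs.ans⟩⟩
  | cons i L =>
    simp only [List.mem_cons, forall_eq_or_imp] at hL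
    have hsp : s.sp = L.length + 1 := hs.sp
    have happly := apply_process (I := I) (s := s) (by omega)
    have hs' : Represented ν I R k e L { s with sp := s.sp - 1 } :=
      ⟨hs.ans, hs.k_eq, by simp [hsp], hs.table, hs.root, hs.tags, hs.env,
        hs.stack.2.congr rfl fun _ _ => ⟨rfl, rfl, rfl⟩⟩
    have hi : ItemAt ν I { s with sp := s.sp - 1 } (s.sp - 1) i := by
      have h1 := hs.stack.1
      rw [hsp, Nat.add_sub_cancel]
      cases i with
      | matching t u => exact h1
      | equal u v => exact h1
    rcases step_or_clash (e := e) hL.1 with ⟨e', L', h⟩ | h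
    · obtain ⟨he', hL'⟩ := h.good he hL.1
      have hw := h.weight_lt
      obtain ⟨s1, hs1, hrep⟩ := represented_step har hI hs' hi h
      have hN' : ((L' ++ L).map Item.weight).sum + 1 ≤ N := by
        simp only [List.map_cons, List.sum_cons] at hN
        simp only [List.map_append, List.sum_append]
        omega
      obtain ⟨m, hm, s2, h2⟩ := ih _ (by omega) hrep he'
        (fun j hj => (List.mem_append.1 hj).elim (hL' j) (hL.2 j)) rfl
      have hr := rounds_process hsk (happly.trans hs1)
      refine ⟨1 + m, by omega, s2, ?_⟩
      rcases h2 with ⟨h3, h4, h5⟩ | ⟨h3, h4, h5⟩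
      · exact Or.inl ⟨h3.mono fun φ hφ => (h.solves_iff hφ L).1, hr.trans h4, h5⟩
      · exact Or.inr ⟨fun φ hφ => (h.solves_iff hφ L).2 (h3 φ hφ), hr.trans h4, h5⟩
    · exact ⟨1, by omega, { s with sp := s.sp - 1 }, Or.inl ⟨h.refutable hA hsol hL.1 L,
        rounds_process hsk (happly.trans (apply_processItem_clash hI hs.table hi h)), hs.k_eq,
        hs.table, hs.root, hs.tags⟩⟩

end Simulation

end RAM

/-! ### From single elements of `S` to the whole set -/

namespace RestrictedConstraint

variable {F Q V : Type*} {ar : F → ℕ} {R : RestrictedConstraint ar Q V}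

theorem solves_matching_iff {t s : Term ar V} {φ : V → Term ar Empty} :
    R.Solves (fun _ => none) [.matching t s] φ ↔ ∃ ψ, R.IsSolution ψ ∧ t.subst ψ = s.subst φ := by
  simp [Solves, Item.Holds]

theorem subst_mem_lang_iff {S : Set (Term ar V)} {s : Term ar V} {φ : V → Term ar Empty} :
    s.subst φ ∈ R.lang S ↔ ∃ t ∈ S, R.Solves (fun _ => none) [.matching t s] φ := by
  simp only [solves_matching_iff]
  constructor
  · rintro ⟨ψ, hψ, t, ht, h⟩
    exact ⟨t, ht, ψ, hψ, h.symm⟩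
  · rintro ⟨t, ht, ψ, hψ, h⟩
    exact ⟨ψ, hψ, t, ht, h.symm⟩

theorem exists_mem_lang_singleton_iff {S : Set (Term ar V)} {s : Term ar V} :
    (∃ t ∈ R.lang {s}, t ∉ R.lang S) ↔ ∃ φ, R.IsSolution φ ∧ s.subst φ ∉ R.lang S := by
  constructor
  · rintro ⟨_, ⟨φ, hφ, s', rfl, rfl⟩, h⟩
    exact ⟨φ, hφ, h⟩
  · rintro ⟨φ, hφ, h⟩
    exact ⟨_, ⟨φ, hφ, s, rfl, rfl⟩, h⟩

theorem envGood_none : R.EnvGood fun _ => none := by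
  intro x u h
  cases h

theorem lang_nonempty {n : ℕ} (hA : R.A.IsOneOr (n + 1)) (q : Q) : (R.A.lang q).Nonempty := by
  rw [← Set.encard_pos]
  rcases hA q with h | h
  · rw [h]; exact one_pos
  · exact lt_of_lt_of_le (by norm_cast; omega) h

/-- If every element of `S` can be avoided, then all of them can be avoided at once. -/
theorem exists_subst_notMem_lang [Finite F] [Finite V] {S : Finset (Term ar V)}
    {s : Term ar V} (hA : R.A.IsOneOr (S.card + 1)) (hsol : ∃ φ, R.IsSolution φ)
    (hS : ∀ t ∈ S, R.Refutable (R.Solves (fun _ => none) [.matching t s]))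
    {B : Set (Term ar Empty)} (hB : B.Finite) :
    ∃ φ, R.IsSolution φ ∧ s.subst φ ∉ R.lang ↑S ∧
      ∀ x, x ∉ R.W → (R.A.lang (R.C x)).Infinite → φ x ∉ B := by
  obtain ⟨φ, hφ, h1, h2⟩ := exists_isSolution_forall_not (ι := S) (n := S.card) (by simp) hA hsol
    (P := fun t => R.Solves (fun _ => none) [.matching (t : Term ar V) s])
    (fun t => hS t t.2) hB
  refine ⟨φ, hφ, fun h => ?_, h2⟩
  obtain ⟨t, ht, h3⟩ := subst_mem_lang_iff.1 h
  exact h1 ⟨t, ht⟩ h3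

/-- By the dichotomy, the alternative would be that all instances of `s`, including the given one,
are instances of `t`. -/
theorem refutable_of_subst_notMem_lang [Finite Q] {S : Finset (Term ar V)} {s : Term ar V}
    (hA : R.A.IsOneOr (S.card + 1)) (hs : R.Good s)
    (hdet : ∀ t ∈ S, ∀ r ∈ t.nonvarPos, s.DeterminedAt r) {φ : V → Term ar Empty}
    (hφ : R.IsSolution φ) (h : s.subst φ ∉ R.lang ↑S) {t : Term ar V} (ht : t ∈ S) :
    R.Refutable (R.Solves (fun _ => none) [.matching t s]) := by
  obtain ⟨n, hn⟩ : ∃ n, S.card = n + 1 :=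
    Nat.exists_eq_succ_of_ne_zero (Finset.card_ne_zero_of_mem ht)
  rw [hn] at hA
  refine (refutable_or_forall_solves hA ⟨φ, hφ⟩ envGood_none
    (L := [.matching t s]) ?_).resolve_right fun h' =>
    h (subst_mem_lang_iff.2 ⟨t, ht, h' φ hφ⟩)
  intro i hi
  rw [List.mem_singleton] at hi
  subst hi
  exact ⟨hdet t ht, hs⟩

/-- If `x` took only finitely many values under such solutions, these values could serve as the set
`B` to be avoided, and a further value would arise. -/
theorem exists_injective_of_subst_notMem_lang [Finite F] [Finite Q] [Finite V]
    {S : Finset (Term ar V)} {s : Term ar V} (hA : R.A.IsOneOr (S.card + 1)) (hs : R.Good s)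
    (hdet : ∀ t ∈ S, ∀ r ∈ t.nonvarPos, s.DeterminedAt r)
    (h : ∃ φ, R.IsSolution φ ∧ s.subst φ ∉ R.lang ↑S) {x : V} (hx : x ∉ R.W)
    (hinf : (R.A.lang (R.C x)).Infinite) :
    ∃ φ : ℕ → V → Term ar Empty, (∀ i, R.IsSolution (φ i) ∧ s.subst (φ i) ∉ R.lang ↑S) ∧
      Function.Injective fun i => φ i x := by
  obtain ⟨φ₀, hφ₀, h₀⟩ := h
  have hvalues : {a | ∃ φ, (R.IsSolution φ ∧ s.subst φ ∉ R.lang ↑S) ∧ φ x = a}.Infinite := by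
    intro hfin
    obtain ⟨φ, hφ, h1, h2⟩ := exists_subst_notMem_lang hA ⟨φ₀, hφ₀⟩
      (fun t ht => refutable_of_subst_notMem_lang hA hs hdet hφ₀ h₀ ht) hfin
    exact h2 x hx hinf ⟨φ, ⟨hφ, h1⟩, rfl⟩
  let g := hvalues.natEmbedding
  choose φ hφ hx using fun i => (g i).2
  refine ⟨φ, hφ, fun i j hij => g.injective (Subtype.ext ?_)⟩
  rw [← hx i, ← hx j]
  exact hij

end RestrictedConstraint

/-! ### Correctness and running time of the program -/

namespace RAM

open RAM.Expr RAM.Prog RestrictedConstraint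

variable {F Q V : Type*} {ar : F → ℕ} {ν : Naming F Q V} {I : ℕ → ℕ}
  {R : RestrictedConstraint ar Q V} {S : Finset (Term ar V)} {s : Term ar V}

/-- The elements of `S` are treated one after the other until one is found that cannot be
avoided. -/
theorem rounds_next [Finite Q] (har : ∀ f, ar f ≤ 2) (hI : ν.Represents I R S s)
    (hA : R.A.IsOneOr (S.card + 1)) (hsol : ∃ φ, R.IsSolution φ) (hs : R.Good s)
    (hdet : ∀ t ∈ S, ∀ r ∈ t.nonvarPos, s.DeterminedAt r) {e : Fin S.card ≃ S}
    (he : ∀ i : Fin S.card, ν.TermAt I (I (I 2 + i)) (e i : Term ar V)) {k : ℕ}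
    (hk : k ≤ S.card) {σ : St} (hσk : σ.k = k + 1) (hσ : TableGood ν I R σ)
    (hroot : σ.run (I 0) ≠ 0) (htags : TagsFresh σ (k + 1)) :
    ∃ m ≤ k * (2 * s.size + 1), ∃ σ' : St,
      Rounds I kE process m (σ.next I).enc σ'.enc ∧ σ'.k = 0 ∧
      ((σ'.ans = 1 ∧ ∀ j : Fin S.card, (j : ℕ) < k →
          R.Refutable (R.Solves (fun _ => none) [.matching (e j : Term ar V) s])) ∨
        (σ'.ans = 0 ∧ ∃ t ∈ S, ∀ φ, R.IsSolution φ →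
          R.Solves (fun _ => none) [.matching t s] φ)) := by
  induction k generalizing σ with
  | zero =>
    exact ⟨0, by simp, _, .zero _, by simp [St.next, hσk], Or.inl ⟨by simp [St.next, hσk],
      fun j hj => absurd hj (by omega)⟩⟩
  | succ k ih =>
    obtain ⟨n, hn⟩ : ∃ n, S.card = n + 1 := ⟨S.card - 1, by omega⟩
    have hA' : R.A.IsOneOr (n + 2) := by rwa [hn] at hA
    let j : Fin S.card := ⟨k, by omega⟩
    have hrep : Represented ν I R (k + 1) (fun _ => none) [.matching (e j : Term ar V) s]
        (σ.next I) := by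
      refine ⟨by simp [St.next, hσk], by simp [St.next, hσk], rfl, hσ, hroot, fun n => ?_,
        fun x => ⟨fun _ h => ?_, fun u hu => (by cases hu)⟩, ⟨?_, trivial⟩⟩
      · exact (htags n).imp_right fun h => by simp only [St.next] at h ⊢; omega
      -- Tags are `0` or were used with larger counters, and the new counter is nonzero; so all
      -- variables start unbound.
      · have := htags (ν.var x)
        simp only [St.next, hσk] at h
        omega
      · have hj := he j
        refine ⟨by simp [St.next], ?_, ?_, fun h => (h rfl).elim, ?_⟩
        · simpa [St.next, hσk] using hj
        · simpa [St.next] using hI.term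
        · simpa [St.next] using hroot
    have hgood : ∀ i ∈ [Item.matching (e j : Term ar V) s], i.Good R := by
      intro i hi
      rw [List.mem_singleton] at hi
      subst hi
      exact ⟨hdet _ (e j).2, hs⟩
    obtain ⟨m, hm, σ', h⟩ := rounds_worklist har hI hA' hsol (Nat.succ_ne_zero k) hrep
      envGood_none hgood
    have hm' : m ≤ 2 * s.size + 1 := by simpa [Item.weight] using hm
    rw [Nat.add_mul, Nat.one_mul]
    rcases h with ⟨href, hr, hk', htab, hroot', htags'⟩ | ⟨hall, hr, hk', hans⟩
    · obtain ⟨m', hm2, σ'', hr', hk'', h⟩ := ih (by omega) hk' htab hroot' htags'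
      refine ⟨m + m', by omega, σ'', hr.trans hr', hk'', h.imp_left fun ⟨h1, h2⟩ =>
        ⟨h1, fun i hi => ?_⟩⟩
      by_cases hik : (i : ℕ) < k
      · exact h2 i hik
      · obtain rfl : i = j := Fin.ext (by simp only [j]; omega)
        exact href
    · exact ⟨m, by omega, σ', hr, hk', Or.inr ⟨hans, _, (e j).2, hall⟩⟩

theorem apply_init : init.apply I (fun _ => 0) =
    St.enc { St.zero with sa := upd St.zero.sa 0 (I 0), sp := 1 } := by
  rw [← St.enc_zero]
  simp [init, Prog.apply, Expr.eval]

theorem apply_start (σ : St) :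
    start.apply I σ.enc = (St.next I { σ with k := I 1 + 1 }).enc := by
  simp [start, Prog.apply, Expr.eval, apply_next]

/-- The program establishes an obstruction for each element of `S` separately;
`exists_subst_notMem_lang` makes this sufficient for a common solution. -/
theorem decidesWithin_decide [Finite F] [Finite Q] [Finite V] (har : ∀ f, ar f ≤ 2)
    (hI : ν.Represents I R S s) (hA : R.A.IsOneOr (S.card + 1)) (hsol : ∃ φ, R.IsSolution φ)
    (hs : R.Good s) (hdet : ∀ t ∈ S, ∀ r ∈ t.nonvarPos, s.DeterminedAt r) :
    DecidesWithin decide I (∃ φ, R.IsSolution φ ∧ s.subst φ ∉ R.lang ↑S)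
      (5 * (decide.maxCost + spE.cost + kE.cost + visit.maxCost + process.maxCost + 2) *
        (s.size * S.card + 1)) := by
  have hsize := s.size_pos
  rcases Nat.eq_zero_or_pos S.card with h0 | hpos
  · obtain rfl := Finset.card_eq_zero.1 h0
    obtain ⟨φ, hφ⟩ := hsol
    have hlang : s.subst φ ∉ R.lang ↑(∅ : Finset (Term ar V)) := by
      simp [RestrictedConstraint.lang]
    refine ⟨_, _, .condFalse (by simpa [Expr.eval] using hI.card) (.store _ _ _), ?_,
      fun _ => by simp [Expr.eval], fun h => (h ⟨φ, hφ, hlang⟩).elim⟩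
    simp only [Finset.card_empty, decide, maxCost]
    omega
  · let σ₁ : St := { St.zero with sa := upd St.zero.sa 0 (I 0), sp := 1 }
    obtain ⟨m₁, hm₁, σ₂, hr₁, hv⟩ := canVisit har hI s (I 0) hI.term σ₁ 0 rfl (by simp [σ₁])
      fun a u _ h => (h rfl).elim
    have htags : TagsFresh { σ₂ with k := I 1 + 1 } (S.card + 1) := fun n => by
      simp [hv.vtag, σ₁, St.zero]
    obtain ⟨e, he⟩ := hI.terms
    obtain ⟨m₂, hm₂, σ₃, hr₂, hk, hans⟩ := rounds_next har hI hA hsol hs hdet he le_rfl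
      (σ := { σ₂ with k := I 1 + 1 }) (by simp [hI.card]) hv.table hv.run htags
    obtain ⟨c₁, hc₁, hx₁⟩ := LoopFree.exec (p := init) (by simp [init, LoopFree]) I fun _ => 0
    obtain ⟨c₂, hc₂, hx₂⟩ := hr₁.exec loopFree_visit (by simpa [spE, Expr.eval] using hv.sp)
    obtain ⟨c₃, hc₃, hx₃⟩ := LoopFree.exec (p := start) (by simp [start, next, LoopFree]) I σ₂.enc
    obtain ⟨c₄, hc₄, hx₄⟩ := hr₂.exec loopFree_process (by simpa [kE, Expr.eval] using hk)
    rw [apply_init] at hx₁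
    rw [apply_start] at hx₃
    refine ⟨_, _, .condTrue (by simp only [Expr.eval, hI.card]; omega)
      (.seq hx₁ (.seq hx₂ (.seq hx₃ hx₄))), ?_, ?_, ?_⟩
    -- `maxCost` counts loops as `0`, so it covers exactly the straight-line parts; the loops are
    -- charged by their numbers of rounds.
    · have hcost : decide.maxCost = (input (lit 1)).cost + 1 + (init.maxCost + (0 +
        (start.maxCost + 0))) + (store (lit 0) (lit 1)).maxCost := rfl
      have h1 : s.size ≤ s.size * S.card := Nat.le_mul_of_pos_right _ hpos
      have h2 : S.card ≤ s.size * S.card := Nat.le_mul_of_pos_left _ hsize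
      -- The traversal takes fewer than `2|s|` rounds and the worklists at most `|S| (2|s| + 1)`; as
      -- `|s|` and `|S|` are positive, `2 + 2 + 1 = 5` multiples of `|s| |S|` suffice.
      have h3 : m₁ + m₂ ≤ 5 * (s.size * S.card) := by
        have : S.card * (2 * s.size + 1) = 2 * (s.size * S.card) + S.card := by ring
        omega
      have h4 : ∀ m c K, c ≤ K → m * c ≤ m * K := fun m c K h => Nat.mul_le_mul_left m h
      generalize hK : decide.maxCost + spE.cost + kE.cost + visit.maxCost + process.maxCost + 2 =
        K
      have h5 := h4 m₁ (spE.cost + 1 + visit.maxCost) K (by omega)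
      have h6 := h4 m₂ (kE.cost + 1 + process.maxCost) K (by omega)
      have h7 := Nat.mul_le_mul_right K h3
      rw [Nat.add_mul] at h7
      have h8 : 5 * K * (s.size * S.card + 1) = 5 * (s.size * S.card) * K + 5 * K := by ring
      rw [h8]
      omega
    · rintro ⟨φ, hφ, h⟩
      rcases hans with ⟨h1, -⟩ | ⟨-, t, ht, h1⟩
      · exact h1
      · exact (h (subst_mem_lang_iff.2 ⟨t, ht, h1 φ hφ⟩)).elim
    · intro h
      rcases hans with ⟨-, h1⟩ | ⟨h1, -⟩
      · obtain ⟨φ, hφ, h2, -⟩ := exists_subst_notMem_lang hA hsol (S := S) (s := s) (fun t ht => by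
          have := h1 (e.symm ⟨t, ht⟩) (Fin.is_lt _)
          rwa [Equiv.apply_symm_apply] at this) Set.finite_empty
        exact (h ⟨φ, hφ, h2⟩).elim
      · exact h1

end RAM

theorem mainTheorem6 :
    ∃ (p : RAM.Prog) (c : ℕ),
      ∀ {F : Type u} {Q : Type v} {V : Type w} [Finite F] [Finite Q] [Finite V]
        (ar : F → ℕ) (_ : ∀ f, ar f ≤ 2)
        (R : RestrictedConstraint ar Q V) (S : Finset (Term ar V)) (s : Term ar V)
        (_ : ∀ x ∈ s.vars, x ∉ R.W)
        (_ : ∀ t ∈ S, ∀ r ∈ t.nonvarPos, s.DeterminedAt r)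
        (_ : R.A.IsOneOr (S.card + 1))
        (_ : Nat.card Q + s.height ≤ R.h),
        (∀ (ν : Naming F Q V) (I : ℕ → ℕ), ν.Represents I R S s →
          RAM.DecidesWithin p I (∃ t ∈ R.lang {s}, t ∉ R.lang ↑S)
            (c * (2 ^ S.card * s.size ^ (2 * S.card + 1) * S.card + 1))) ∧
        ((∃ t ∈ R.lang {s}, t ∉ R.lang ↑S) →
          ∀ x, (s.varPos x).Nontrivial → (R.A.lang (R.C x)).Infinite →
            ∃ φ : ℕ → V → Term ar Empty,
              (∀ i, R.IsSolution (φ i) ∧ s.subst (φ i) ∉ R.lang ↑S) ∧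
              Function.Injective fun i => φ i x) := by
  refine ⟨RAM.decide, 5 * (RAM.decide.maxCost + RAM.Expr.spE.cost + RAM.Expr.kE.cost +
    RAM.visit.maxCost + RAM.process.maxCost + 2), ?_⟩
  intro F Q V _ _ _ ar har R S s hW hdet hA hh
  have hs : R.Good s := ⟨Term.allVars_of_forall_mem_vars hW, hh⟩
  have hsol : ∃ φ, R.IsSolution φ :=
    RestrictedConstraint.exists_isSolution (RestrictedConstraint.lang_nonempty hA) (by omega)
  rw [RestrictedConstraint.exists_mem_lang_singleton_iff]
  constructor
  · intro ν I hI
    obtain ⟨M, n, h1, h2, h3⟩ := RAM.decidesWithin_decide har hI hA hsol hs hdet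
    refine ⟨M, n, h1, h2.trans (Nat.mul_le_mul_left _ (Nat.add_le_add_right ?_ 1)), h3⟩
    -- The linear bound `|s| |S|` is weakened to the required one.
    refine Nat.mul_le_mul_right _ ((Nat.le_self_pow (show 2 * S.card + 1 ≠ 0 by omega) _).trans ?_)
    exact Nat.le_mul_of_pos_left _ (Nat.two_pow_pos _)
  · intro h x hx hinf
    exact RestrictedConstraint.exists_injective_of_subst_notMem_lang hA hs hdet h
      (hW x hx.nonempty) hinf
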